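/- **Setting.** Let $p$ be a prime and $P$ a finite $p$-group. A *divisible $P$-category* $\mathcal F$ is a subcategory of the category of finite groups whose objects are the subgroups of $P$, whose morphisms are injective homomorphisms, which contains all homomorphisms $Q\to R$ ($Q,R\le P$) induced by conjugation by elements of $P$, and such that, whenever $\varphi\in\mathcal F(Q,R)$ and $\psi\in\mathcal F(Q,T)$ (morphisms $R\to Q$ and $T\to Q$) and $\theta\colon R\to T$ is a group homomorphism with $\psi\circ\theta=\varphi$, then $\theta\in\mathcal F(T,R)$. Write $\mathcal F(P,Q)$ for the set of $\mathcal F$-morphisms $Q\to P$, $\mathcal F(Q)$ for the group of $\mathcal F$-automorphisms of $Q$, $\mathcal F_P(Q)$ for the group of automorphisms of $Q$ induced by $N_P(Q)$, and $\iota_Q\colon Q\to P$ for the inclusion. $\mathcal F$ is a *Frobenius $P$-category* if $\mathcal F_P(P)$ is a Sylow $p$-subgroup of $\mathcal F(P)$ and every $\varphi\in\mathcal F(P,Q)$ such that $\zeta\big(C_P(\varphi(Q))\big)=C_P\big(\zeta(\varphi(Q))\big)$ for every $\mathcal F$-morphism $\zeta\colon\varphi(Q)\,C_P(\varphi(Q))\to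 P$ extends to an $\mathcal F$-morphism $N\to P$, where $N$ is the group of all $u\in N_P(Q)$ for which there is $v\in N_P(\varphi(Q))$ with $\varphi(uxu^{-1})=v\varphi(x)v^{-1}$ for all $x\in Q$. For finite groups $G,H$ let $\mathcal B_{G,H}$ be the free $\mathbb Z$-module on the isomorphism classes of transitive $G\times H$-sets; a finite $G\times H$-set determines the sum of the classes of its orbits. For $G\times H$-sets $X$ and $H\times K$-sets $Y$, let $X\times_H Y$ be the $G\times K$-set of the orbits of $H$ on $X\times Y$, where $h$ sends $(x,y)$ to $\big((1,h)x,(h,1)y\big)$; it induces biadditive products $\mathcal B_{G,H}\times\mathcal B_{H,K}\to\mathcal B_{G,K}$, and $\mathcal B_{P,P}$ (written $\mathcal B_{P\times P}$, the double Burnside algebra of $P$) becomes a ring. Let $f\mapsto f^\circ$ be the additive involution of $\mathcal B_{P\times P}$ exchanging the two factors $P$. For a homomorphism $\varphi\colon Q\to P$ with $Q\le P$, put $\Delta_\varphi(Q)=\{(\varphi(u),u)\mid u\in Q\}$, let $f_{Q,\varphi}\in\mathcal B_{P\times P}$ be the class of $(P\times P)/\Delta_\varphi(Q)$, and let $\mathrm{res}_\varphi\in\mathcal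 B_{Q,P}$ be the class of the $Q\times P$-set $P$ on which $(u,v)$ sends $w$ to $\varphi(u)wv^{-1}$. The *Hecke algebra* $\mathcal H_{\mathcal F}$ of $\mathcal F$ is the subring of $\mathcal B_{P\times P}$ spanned over $\mathbb Z$ by all $f_{Q,\varphi}$ with $Q\le P$ and $\varphi\in\mathcal F(P,Q)$. With $\mathcal H=\mathcal H_{\mathcal F}$, let $\mathcal H^{\mathcal F}$ be the set of $f\in\mathcal H$ such that $\mathrm{res}_\varphi\cdot f=\mathrm{res}_{\iota_Q}\cdot f$ and $\mathrm{res}_\varphi\cdot f^\circ=\mathrm{res}_{\iota_Q}\cdot f^\circ$ for all $Q\le P$ and $\varphi\in\mathcal F(P,Q)$. The *length* is the additive map $\ell$ on $\mathcal H$ with $\ell(f_{Q,\varphi})=|(P\times P)/\Delta_\varphi(Q)|/|P|=|P:Q|$. For $f\in\mathcal H$, let $\mathcal H_f$ be the minimal Hecke algebra containing $f$, that is, the intersection of all $\mathcal H_{\mathcal F'}\ni f$ with $\mathcal F'$ a divisible $P$-category, and let $\mathcal F^f$ be the divisible $P$-category for which $\mathcal F^f(P,Q)$ consists of the injective homomorphisms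 $\varphi\colon Q\to P$ with $\mathrm{res}_\varphi\cdot f=\mathrm{res}_{\iota_Q}\cdot f$ and $\mathrm{res}_\varphi\cdot f^\circ=\mathrm{res}_{\iota_Q}\cdot f^\circ$, a homomorphism $Q\to R$ being a morphism of $\mathcal F^f$ when its composite with $\iota_R$ lies in $\mathcal F^f(P,Q)$. **Proposition 7.6.** Let $\mathcal F$ be a divisible $P$-category and put $\mathcal H=\mathcal H_{\mathcal F}$. If $f\in\mathcal H^{\mathcal F}$ and $\ell(f)$ is prime to $p$, then $\mathcal F$ is a Frobenius $P$-category, $\mathcal F^f=\mathcal F$ and $\mathcal H_f=\mathcal H$. -/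

import Mathlib

namespace Puig

open MulAction

/-! ### Conjugacy classes of subgroups and the class of a finite `H × G`-set -/

section Classes

variable (A : Type*) [Group A]

/-- Two subgroups are equivalent when they are conjugate. -/
def conjSetoid : Setoid (Subgroup A) where
  r D E := ∃ a : A, E = D.map (MulAut.conj a).toMonoidHom
  iseqv :=
    { refl := fun D => ⟨1, by ext x; simp⟩
      symm := by
        rintro D E ⟨a, rfl⟩
        refine ⟨a⁻¹, ?_⟩
        ext x
        simp [mul_assoc]
      trans := by
        rintro D E K ⟨a, rfl⟩ ⟨b, rfl⟩
        refine ⟨b * a, ?_⟩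
        rw [Subgroup.map_map]
        congr 1
        ext x
        simp [mul_assoc] }

/-- Conjugacy classes of subgroups of `A`; they label the isomorphism classes of transitive
`A`-sets, the class of `D` corresponding to `A / D`. -/
def SubgroupConjClass : Type _ := Quotient (conjSetoid A)

variable {A}

/-- The conjugacy class of a subgroup. -/
def SubgroupConjClass.mk (D : Subgroup A) : SubgroupConjClass A := Quotient.mk (conjSetoid A) D

/-- A subgroup representing a conjugacy class. -/
noncomputable def SubgroupConjClass.out (c : SubgroupConjClass A) : Subgroup A := Quotient.out c

theorem SubgroupConjClass.mk_out (c : SubgroupConjClass A) : SubgroupConjClass.mk c.out = c :=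
  Quotient.out_eq c

theorem SubgroupConjClass.mk_eq_mk {D E : Subgroup A} :
    SubgroupConjClass.mk D = SubgroupConjClass.mk E ↔ ∃ a : A, E = D.map (MulAut.conj a).toMonoidHom :=
  Quotient.eq (r := conjSetoid A)

/-- The isomorphism class of an orbit, given by the conjugacy class of the point stabilizers. -/
def stabClass {X : Type*} [MulAction A X] : orbitRel.Quotient A X → SubgroupConjClass A :=
  Quotient.lift (fun x => SubgroupConjClass.mk (stabilizer A x)) (by
    rintro x y ⟨a, rfl⟩
    exact (SubgroupConjClass.mk_eq_mk.2 ⟨a, stabilizer_smul_eq_stabilizer_map_conj a y⟩).symm)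

end Classes

/-- The double Burnside module: the free `ℤ`-module over the set of isomorphism classes of
transitive `H × G`-sets `(H × G) / D` (equivalently, of the indecomposable functors from finite
`G`-sets to finite `H`-sets that they determine). -/
def Burnside (H G : Type*) [Group H] [Group G] : Type _ := SubgroupConjClass (H × G) →₀ ℤ

section Burnside

variable {H G : Type*} [Group H] [Group G]

noncomputable instance : AddCommGroup (Burnside H G) :=
  inferInstanceAs (AddCommGroup (SubgroupConjClass (H × G) →₀ ℤ))

/-- The basis element given by a conjugacy class of subgroups. -/
noncomputable def Burnside.basis (c : SubgroupConjClass (H × G)) : Burnside H G := Finsupp.single c 1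

/-- The isomorphism class of the transitive `H × G`-set `(H × G) / D`. -/
noncomputable def Burnside.ofSubgroup (D : Subgroup (H × G)) : Burnside H G :=
  Burnside.basis (SubgroupConjClass.mk D)

variable (H G) in
/-- The element determined by a finite `H × G`-set: the sum of the classes of its orbits. -/
noncomputable def bisetClass (X : Type*) [MulAction (H × G) X] : Burnside H G :=
  ∑ᶠ o : orbitRel.Quotient (H × G) X, Burnside.basis (stabClass o)

/-- The additive extension of a map defined on the canonical basis. -/
noncomputable def Burnside.extend {M : Type*} [AddCommGroup M]
    (φ : SubgroupConjClass (H × G) → M) : Burnside H G →+ M :=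
  Finsupp.liftAddHom fun c => zmultiplesHom M (φ c)

theorem Burnside.extend_basis {M : Type*} [AddCommGroup M]
    (φ : SubgroupConjClass (H × G) → M) (c : SubgroupConjClass (H × G)) :
    Burnside.extend φ (Burnside.basis c) = φ c := by
  unfold Burnside.extend Burnside.basis
  erw [Finsupp.liftAddHom_apply_single]
  simp

theorem Burnside.induction {p : Burnside H G → Prop} (x : Burnside H G)
    (hb : ∀ c, p (Burnside.basis c)) (h0 : p 0) (hadd : ∀ x y, p x → p y → p (x + y))
    (hneg : ∀ x, p x → p (-x)) : p x := by
  have hz : ∀ (n : ℤ) (x : Burnside H G), p x → p (n • x) := by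
    intro n x hx
    induction n with
    | zero => simpa using h0
    | succ n ih => rw [add_zsmul, one_zsmul]; exact hadd _ _ ih hx
    | pred n ih => rw [sub_eq_add_neg, add_zsmul, neg_one_zsmul]; exact hadd _ _ ih (hneg _ hx)
  refine Finsupp.induction_linear (motive := p) x h0 hadd ?_
  intro c n
  have := hz n _ (hb c)
  have e : n • Burnside.basis c = (Finsupp.single c n : SubgroupConjClass (H × G) →₀ ℤ) := by
    unfold Burnside.basis
    erw [Finsupp.smul_single]
    exact congrArg (Finsupp.single c) (mul_one n)
  rwa [e] at this

theorem Burnside.hom_ext {M : Type*} [AddCommGroup M] {φ ψ : Burnside H G →+ M}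
    (h : ∀ c, φ (Burnside.basis c) = ψ (Burnside.basis c)) : φ = ψ := by
  ext x
  refine Burnside.induction (p := fun x => φ x = ψ x) x h (by simp) ?_ ?_
  · intro x y hx hy; simp [hx, hy]
  · intro x hx; simp [hx]

/-- A finite decomposition of a biset into bisets gives a sum of classes. -/
theorem bisetClass_decomp {I : Type*} [Finite I] {Z : Type*} [MulAction (H × G) Z] [Finite Z]
    {W : I → Type*} [∀ i, MulAction (H × G) (W i)] (f : ∀ i, W i → Z)
    (hf : ∀ i (a : H × G) w, f i (a • w) = a • f i w)
    (hb : Function.Bijective (fun s : Σ i, W i => f s.1 s.2)) :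
    bisetClass H G Z = ∑ᶠ i, bisetClass H G (W i) := by
  classical
  have hfin : ∀ i, Finite (W i) := fun i =>
    Finite.of_injective (f i) (fun a b h => by
      have := hb.1 (a₁ := ⟨i, a⟩) (a₂ := ⟨i, b⟩) h
      simpa using this)
  let e : (Σ i, orbitRel.Quotient (H × G) (W i)) → orbitRel.Quotient (H × G) Z := fun s =>
    Quotient.map' (f s.1) (by
      rintro x y ⟨a, rfl⟩
      exact ⟨a, (hf s.1 a y).symm⟩) s.2
  have he : Function.Bijective e := by
    constructor
    · rintro ⟨i, o⟩ ⟨j, o'⟩ h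
      induction o using Quotient.inductionOn' with | _ x
      induction o' using Quotient.inductionOn' with | _ y
      have h' : f i x ∈ orbit (H × G) (f j y) := Quotient.exact h
      obtain ⟨a, ha⟩ := h'
      have h2 : (⟨j, a • y⟩ : Σ i, W i) = ⟨i, x⟩ := hb.1 (by
        change f j (a • y) = f i x
        rw [hf]; exact ha)
      obtain ⟨rfl, h3⟩ := Sigma.mk.inj_iff.1 h2
      have h3 := eq_of_heq h3
      congr 1
      exact Quotient.sound ⟨a, h3⟩
    · intro o
      induction o using Quotient.inductionOn' with | _ z
      obtain ⟨⟨i, x⟩, hx⟩ := hb.2 z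
      exact ⟨⟨i, Quotient.mk _ x⟩, congrArg (Quotient.mk _) hx⟩
  have hs : ∀ s, stabClass (e s) = stabClass s.2 := by
    rintro ⟨i, o⟩
    induction o using Quotient.inductionOn' with | _ x
    change SubgroupConjClass.mk (stabilizer (H × G) (f i x)) = SubgroupConjClass.mk (stabilizer (H × G) x)
    congr 1
    ext a
    rw [mem_stabilizer_iff, mem_stabilizer_iff, ← hf]
    constructor
    · intro h
      have := hb.1 (a₁ := ⟨i, a • x⟩) (a₂ := ⟨i, x⟩) h
      simpa using this
    · intro h; rw [h]
  have : ∀ i, Finite (orbitRel.Quotient (H × G) (W i)) := fun i => Quotient.finite _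
  have : Finite (orbitRel.Quotient (H × G) Z) := Quotient.finite _
  have := Fintype.ofFinite I
  have := fun i => Fintype.ofFinite (orbitRel.Quotient (H × G) (W i))
  have := Fintype.ofFinite (orbitRel.Quotient (H × G) Z)
  unfold bisetClass
  simp only [finsum_eq_sum_of_fintype]
  rw [← Fintype.sum_sigma (fun s : (Σ i, orbitRel.Quotient (H × G) (W i)) =>
    (Burnside.basis (stabClass s.2) : Burnside H G))]
  exact (Fintype.sum_bijective e he _ _ (fun s => by rw [hs])).symm

/-- Isomorphic bisets have the same class. -/
theorem bisetClass_congr {Z W : Type*} [MulAction (H × G) Z] [MulAction (H × G) W] [Finite Z]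
    (f : W → Z) (hf : ∀ (a : H × G) w, f (a • w) = a • f w) (hb : Function.Bijective f) :
    bisetClass H G Z = bisetClass H G W := by
  rw [bisetClass_decomp (I := Unit) (W := fun _ => W) (fun _ => f) (fun _ => hf)]
  · simp [finsum_eq_sum_of_fintype]
  · refine ⟨?_, ?_⟩
    · rintro ⟨_, a⟩ ⟨_, b⟩ h
      have : a = b := hb.1 h
      rw [this]
    · intro z
      obtain ⟨w, hw⟩ := hb.2 z
      exact ⟨⟨(), w⟩, hw⟩

theorem bisetClass_quotient (D : Subgroup (H × G)) :
    bisetClass H G ((H × G) ⧸ D) = Burnside.ofSubgroup D := by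
  let o : orbitRel.Quotient (H × G) ((H × G) ⧸ D) :=
    Quotient.mk _ ((1 : H × G) : (H × G) ⧸ D)
  have ho : ∀ o', o' = o := by
    intro o'
    induction o' using Quotient.inductionOn' with | _ x
    exact Quotient.sound (exists_smul_eq (H × G) _ x)
  have : Unique (orbitRel.Quotient (H × G) ((H × G) ⧸ D)) := ⟨⟨o⟩, ho⟩
  unfold bisetClass
  rw [finsum_unique, ho (@default _ this.toInhabited)]
  change Burnside.basis (SubgroupConjClass.mk _) = _
  rw [stabilizer_quotient]
  rfl

/-- Every basis element is the class of a coset space. -/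
theorem basis_eq (c : SubgroupConjClass (H × G)) :
    Burnside.basis c = bisetClass H G ((H × G) ⧸ c.out) := by
  rw [bisetClass_quotient, Burnside.ofSubgroup, SubgroupConjClass.mk_out]

/-- In every orbit there is a point whose stabilizer is the chosen representative. -/
theorem exists_point {X : Type*} [MulAction (H × G) X] (o : orbitRel.Quotient (H × G) X) :
    ∃ x : X, Quotient.mk _ x = o ∧ stabilizer (H × G) x = (stabClass o).out := by
  induction o using Quotient.inductionOn' with | _ x
  have h : SubgroupConjClass.mk (stabilizer (H × G) x) =
      SubgroupConjClass.mk (stabClass (Quotient.mk (orbitRel (H × G) X) x)).out := by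
    rw [SubgroupConjClass.mk_out]; rfl
  obtain ⟨a, ha⟩ := SubgroupConjClass.mk_eq_mk.1 h
  refine ⟨a • x, Quotient.sound ⟨a, rfl⟩, ?_⟩
  rw [stabilizer_smul_eq_stabilizer_map_conj]
  exact ha.symm

/-- A biset is the disjoint union of the coset spaces attached to its orbits. -/
theorem exists_decomp (X : Type*) [MulAction (H × G) X] :
    ∃ u : ∀ o : orbitRel.Quotient (H × G) X, (H × G) ⧸ (stabClass o).out → X,
      (∀ o (a : H × G) w, u o (a • w) = a • u o w) ∧
      Function.Bijective
        (fun s : Σ o : orbitRel.Quotient (H × G) X, (H × G) ⧸ (stabClass o).out => u s.1 s.2) := by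
  choose y hy hst using fun o : orbitRel.Quotient (H × G) X => exists_point o
  let u : ∀ o : orbitRel.Quotient (H × G) X, (H × G) ⧸ (stabClass o).out → X := fun o q =>
    Quotient.liftOn' q (fun a => a • y o) (by
      intro a b hab
      rw [QuotientGroup.leftRel_apply, ← hst o, mem_stabilizer_iff, mul_smul,
        inv_smul_eq_iff] at hab
      exact hab.symm)
  refine ⟨u, ?_, ?_, ?_⟩
  · intro o a w
    induction w using Quotient.inductionOn' with | _ b
    exact mul_smul a b (y o)
  · rintro ⟨o, w⟩ ⟨o', w'⟩ h
    induction w using Quotient.inductionOn' with | _ a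
    induction w' using Quotient.inductionOn' with | _ b
    have h : a • y o = b • y o' := h
    have ho : o = o' := by
      rw [← hy o, ← hy o']
      refine Quotient.sound ⟨a⁻¹ * b, ?_⟩
      change (a⁻¹ * b) • y o' = y o
      rw [mul_smul, ← h, inv_smul_smul]
    subst ho
    congr 1
    refine Quotient.sound' ?_
    rw [QuotientGroup.leftRel_apply, ← hst o, mem_stabilizer_iff, mul_smul, ← h, inv_smul_smul]
  · intro x
    obtain ⟨a, ha⟩ : x ∈ orbit (H × G) (y (Quotient.mk _ x)) :=
      Quotient.exact (hy (Quotient.mk _ x)).symm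
    exact ⟨⟨Quotient.mk _ x, Quotient.mk'' a⟩, ha⟩

end Burnside

/-! ### Composition -/

section Tensor

variable (G H K : Type*) [Group G] [Group H] [Group K]
variable (X Y : Type*) [MulAction (G × H) X] [MulAction (H × K) Y]

/-- The orbit relation of `H` on `X × Y`, where `h` sends `(x, y)` to `((1, h) • x, (h, 1) • y)`. -/
def tensorSetoid : Setoid (X × Y) where
  r s t := ∃ h : H, ((1, h) : G × H) • s.1 = t.1 ∧ ((h, 1) : H × K) • s.2 = t.2
  iseqv :=
    { refl := fun s => ⟨1, one_smul _ s.1, one_smul _ s.2⟩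
      symm := by
        rintro ⟨x, y⟩ ⟨_, _⟩ ⟨h, rfl, rfl⟩
        exact ⟨h⁻¹, by simp [smul_smul, ← Prod.one_eq_mk], by simp [smul_smul, ← Prod.one_eq_mk]⟩
      trans := by
        rintro ⟨x, y⟩ ⟨_, _⟩ ⟨_, _⟩ ⟨h, rfl, rfl⟩ ⟨h', rfl, rfl⟩
        exact ⟨h' * h, by simp [smul_smul], by simp [smul_smul]⟩ }

/-- The `G × K`-set `X ×_H Y` of the `H`-orbits on `X × Y`. -/
def Tensor : Type _ := Quotient (tensorSetoid G H K X Y)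

variable {X Y}

/-- The orbit of `(x, y)` in `X ×_H Y`. -/
def Tensor.mk (x : X) (y : Y) : Tensor G H K X Y := Quotient.mk (tensorSetoid G H K X Y) (x, y)

variable {G H K}

theorem Tensor.mk_eq {x x' : X} {y y' : Y} : Tensor.mk G H K x y = Tensor.mk G H K x' y' ↔
    ∃ h : H, ((1, h) : G × H) • x = x' ∧ ((h, 1) : H × K) • y = y' :=
  Quotient.eq (r := tensorSetoid G H K X Y)

theorem Tensor.ind {p : Tensor G H K X Y → Prop} (h : ∀ x y, p (Tensor.mk G H K x y)) (t) : p t :=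
  Quotient.ind (fun s => h s.1 s.2) t

/-- Maps out of `X ×_H Y`. -/
def Tensor.lift {Z : Type*} (f : X → Y → Z)
    (hf : ∀ (h : H) x y, f (((1, h) : G × H) • x) (((h, 1) : H × K) • y) = f x y) :
    Tensor G H K X Y → Z :=
  Quotient.lift (fun s : X × Y => f s.1 s.2) (by
    rintro ⟨x, y⟩ ⟨_, _⟩ ⟨h, rfl, rfl⟩
    exact (hf h x y).symm)

instance Tensor.instMulAction : MulAction (G × K) (Tensor G H K X Y) where
  smul a := Tensor.lift
    (fun x y => Tensor.mk G H K (((a.1, 1) : G × H) • x) (((1, a.2) : H × K) • y)) (by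
      intro h x y
      exact (Tensor.mk_eq.2 ⟨h, by simp [smul_smul], by simp [smul_smul]⟩).symm)
  one_smul t := by
    induction t using Tensor.ind with | _ x y
    change Tensor.mk G H K ((1 : G × H) • x) ((1 : H × K) • y) = _
    simp
  mul_smul a b t := by
    induction t using Tensor.ind with | _ x y
    change Tensor.mk G H K _ _ = Tensor.mk G H K _ _
    simp [smul_smul]

theorem Tensor.smul_mk (a : G × K) (x : X) (y : Y) : a • Tensor.mk G H K x y =
    Tensor.mk G H K (((a.1, 1) : G × H) • x) (((1, a.2) : H × K) • y) := rfl

instance [Finite X] [Finite Y] : Finite (Tensor G H K X Y) := Quotient.finite _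

end Tensor

section Comp

variable {G H K L : Type*} [Group G] [Group H] [Group K] [Group L]

/-- The biadditive composition of double Burnside modules, given on the canonical bases by the
composition of functors, that is, by the bisets `X ×_H Y`. -/
noncomputable def comp : Burnside G H →+ Burnside H K →+ Burnside G K :=
  Burnside.extend fun c => Burnside.extend fun d =>
    bisetClass G K (Tensor G H K ((G × H) ⧸ c.out) ((H × K) ⧸ d.out))

theorem comp_basis (c : SubgroupConjClass (G × H)) (d : SubgroupConjClass (H × K)) :
    comp (Burnside.basis c) (Burnside.basis d) =
      bisetClass G K (Tensor G H K ((G × H) ⧸ c.out) ((H × K) ⧸ d.out)) := by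
  rw [comp, Burnside.extend_basis, Burnside.extend_basis]

/-- Composition of the classes of two finite bisets. -/
theorem comp_bisetClass (X Y : Type*) [MulAction (G × H) X] [MulAction (H × K) Y]
    [Finite X] [Finite Y] :
    comp (bisetClass G H X) (bisetClass H K Y) = bisetClass G K (Tensor G H K X Y) := by
  obtain ⟨u, hu, hub⟩ := exists_decomp (H := G) (G := H) X
  obtain ⟨v, hv, hvb⟩ := exists_decomp (H := H) (G := K) Y
  have : Finite (orbitRel.Quotient (G × H) X) := Quotient.finite _
  have : Finite (orbitRel.Quotient (H × K) Y) := Quotient.finite _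
  rw [bisetClass_decomp (I := orbitRel.Quotient (G × H) X × orbitRel.Quotient (H × K) Y)
    (W := fun i => Tensor G H K ((G × H) ⧸ (stabClass i.1).out) ((H × K) ⧸ (stabClass i.2).out))
    (fun i => Tensor.lift (fun a b => Tensor.mk G H K (u i.1 a) (v i.2 b)) (by
      intro h x y
      rw [hu, hv]
      exact (Tensor.mk_eq.2 ⟨h, rfl, rfl⟩).symm))]
  · have := Fintype.ofFinite (orbitRel.Quotient (G × H) X)
    have := Fintype.ofFinite (orbitRel.Quotient (H × K) Y)
    rw [finsum_eq_sum_of_fintype, Fintype.sum_prod_type]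
    conv_lhs => rw [bisetClass, bisetClass, finsum_eq_sum_of_fintype, finsum_eq_sum_of_fintype]
    simp only [map_sum, AddMonoidHom.finsetSum_apply, comp_basis]
    exact Finset.sum_comm
  · intro i a w
    induction w using Tensor.ind with | _ x y
    change Tensor.mk G H K (u i.1 _) (v i.2 _) = Tensor.mk G H K _ _
    rw [hu, hv]
  · constructor
    · rintro ⟨⟨o, o'⟩, w⟩ ⟨⟨q, q'⟩, w'⟩ h
      induction w using Tensor.ind with | _ x y
      induction w' using Tensor.ind with | _ x' y'
      obtain ⟨b, h1, h2⟩ := Tensor.mk_eq.1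
        (show Tensor.mk G H K (u o x) (v o' y) = Tensor.mk G H K (u q x') (v q' y') from h)
      rw [← hu] at h1
      rw [← hv] at h2
      have e1 := hub.1 (a₁ := ⟨o, _⟩) (a₂ := ⟨q, x'⟩) h1
      have e2 := hvb.1 (a₁ := ⟨o', _⟩) (a₂ := ⟨q', y'⟩) h2
      obtain ⟨rfl, e1⟩ := Sigma.mk.inj_iff.1 e1
      obtain ⟨rfl, e2⟩ := Sigma.mk.inj_iff.1 e2
      congr 1
      exact Tensor.mk_eq.2 ⟨b, eq_of_heq e1, eq_of_heq e2⟩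
    · intro t
      induction t using Tensor.ind with | _ x y
      obtain ⟨⟨o, a⟩, rfl⟩ := hub.2 x
      obtain ⟨⟨o', b⟩, rfl⟩ := hvb.2 y
      exact ⟨⟨(o, o'), Tensor.mk G H K a b⟩, rfl⟩

theorem comp_assoc [Finite G] [Finite H] [Finite K] [Finite L]
    (a : Burnside G H) (b : Burnside H K) (c : Burnside K L) :
    comp (comp a b) c = comp a (comp b c) := by
  refine Burnside.induction
    (p := fun a => comp (comp a b) c = comp a (comp b c)) a ?_ (by simp) ?_ ?_
  rotate_left
  · intro x y hx hy; simp [hx, hy]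
  · intro x hx; simp [hx]
  intro ca
  refine Burnside.induction (p := fun b => comp (comp (Burnside.basis ca) b) c =
    comp (Burnside.basis ca) (comp b c)) b ?_ (by simp) ?_ ?_
  rotate_left
  · intro x y hx hy; simp [hx, hy]
  · intro x hx; simp [hx]
  intro cb
  refine Burnside.induction (p := fun c => comp (comp (Burnside.basis ca) (Burnside.basis cb)) c =
    comp (Burnside.basis ca) (comp (Burnside.basis cb) c)) c ?_ (by simp) ?_ ?_
  rotate_left
  · intro x y hx hy; simp [hx, hy]
  · intro x hx; simp [hx]
  intro cc
  rw [basis_eq ca, basis_eq cb, basis_eq cc]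
  generalize ca.out = A, cb.out = B, cc.out = C
  have : Finite ((G × H) ⧸ A) := Quotient.finite _
  have : Finite ((H × K) ⧸ B) := Quotient.finite _
  have : Finite ((K × L) ⧸ C) := Quotient.finite _
  rw [comp_bisetClass, comp_bisetClass, comp_bisetClass, comp_bisetClass]
  refine bisetClass_congr
    (Tensor.lift (fun x t => Tensor.lift
      (fun y z => Tensor.mk G K L (Tensor.mk G H K x y) z) ?_ t) ?_) ?_ ⟨?_, ?_⟩
  · intro k y z
    refine (Tensor.mk_eq.2 ⟨k, ?_, rfl⟩).symm
    rw [Tensor.smul_mk]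
    exact congrArg (fun w => Tensor.mk G H K w _) (one_smul (G × H) x)
  · intro h x t
    induction t using Tensor.ind with | _ y z
    change Tensor.mk G K L (Tensor.mk G H K _ _) _ = Tensor.mk G K L (Tensor.mk G H K _ _) _
    congr 1
    · exact (Tensor.mk_eq.2 ⟨h, rfl, rfl⟩).symm
    · exact one_smul _ z
  · intro a t
    induction t using Tensor.ind with | _ x t
    induction t using Tensor.ind with | _ y z
    change Tensor.mk G K L (Tensor.mk G H K (((a.1, 1) : G × H) • x) (((1, 1) : H × K) • y)) _ =
      Tensor.mk G K L (Tensor.mk G H K (((a.1, 1) : G × H) • x) (((1, 1) : H × K) • y)) _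
    rfl
  · intro s t h
    induction s using Tensor.ind with | _ x s
    induction s using Tensor.ind with | _ y z
    induction t using Tensor.ind with | _ x' t
    induction t using Tensor.ind with | _ y' z'
    obtain ⟨k, h1, h2⟩ := Tensor.mk_eq.1
      (show Tensor.mk G K L (Tensor.mk G H K x y) z = Tensor.mk G K L (Tensor.mk G H K x' y') z'
        from h)
    rw [Tensor.smul_mk] at h1
    obtain ⟨l, h3, h4⟩ := Tensor.mk_eq.1 h1
    refine Tensor.mk_eq.2 ⟨l, ?_, ?_⟩
    · rw [← h3]; exact congrArg (((1, l) : G × H) • ·) (one_smul (G × H) x).symm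
    · rw [Tensor.smul_mk]
      refine Tensor.mk_eq.2 ⟨k, ?_, ?_⟩
      · rw [← h4]; simp [smul_smul]
      · rw [← h2]; exact congrArg (((k, 1) : K × L) • ·) (one_smul (K × L) z)
  · intro t
    induction t using Tensor.ind with | _ t z
    induction t using Tensor.ind with | _ x y
    exact ⟨Tensor.mk G H L x (Tensor.mk H K L y z), rfl⟩

/-- The underlying set `G` of the biset of a restriction functor. -/
@[ext]
structure ResBiset {H G : Type*} [Group H] [Group G] (α : H →* G) where
  val : G

instance {H G : Type*} [Group H] [Group G] (α : H →* G) : MulAction (H × G) (ResBiset α) where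
  smul a v := ⟨α a.1 * v.val * a.2⁻¹⟩
  one_smul v := ResBiset.ext (show (α 1 * v.val * 1⁻¹ : G) = v.val by simp)
  mul_smul a b v := ResBiset.ext (show (α (a.1 * b.1) * v.val * (a.2 * b.2)⁻¹ : G) =
    α a.1 * (α b.1 * v.val * b.2⁻¹) * a.2⁻¹ by simp [mul_assoc])

instance {H G : Type*} [Group H] [Group G] [Finite G] (α : H →* G) : Finite (ResBiset α) :=
  Finite.of_injective ResBiset.val fun _ _ h => ResBiset.ext h

theorem ResBiset.smul_val {H G : Type*} [Group H] [Group G] (α : H →* G) (a : H × G)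
    (v : ResBiset α) : (a • v).val = α a.1 * v.val * a.2⁻¹ := rfl

/-- The element `res_α` given by restriction along `α : H → G`, that is, by the `H × G`-set `G`
where `(h, g)` sends `v` to `α h * v * g⁻¹`. -/
noncomputable def res {H G : Type*} [Group H] [Group G] (α : H →* G) : Burnside H G :=
  bisetClass H G (ResBiset α)

theorem res_comp [Finite G] [Finite H] (α : K →* H) (β : H →* G) :
    comp (res α) (res β) = res (β.comp α) := by
  rw [res, res, comp_bisetClass]
  refine (bisetClass_congr (Tensor.lift (Z := ResBiset (β.comp α))
    (fun (v : ResBiset α) (w : ResBiset β) => ⟨β v.val * w.val⟩) ?_) ?_ ⟨?_, ?_⟩).symm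
  · intro h v w
    simp [ResBiset.smul_val, mul_assoc]
  · intro a t
    induction t using Tensor.ind with | _ v w
    refine ResBiset.ext ?_
    change (β (α a.1 * v.val * 1⁻¹) * (β 1 * w.val * a.2⁻¹) : G) =
      β (α a.1) * (β v.val * w.val) * a.2⁻¹
    simp [mul_assoc]
  · intro s t h
    induction s using Tensor.ind with | _ v w
    induction t using Tensor.ind with | _ v' w'
    have h : (β v.val * w.val : G) = β v'.val * w'.val := congrArg ResBiset.val h
    refine Tensor.mk_eq.2 ⟨v'.val⁻¹ * v.val, ResBiset.ext ?_, ResBiset.ext ?_⟩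
    · simp [ResBiset.smul_val]
    · rw [ResBiset.smul_val, map_mul, mul_assoc, mul_assoc, inv_one, mul_one, h]
      simp
  · intro w
    exact ⟨Tensor.mk _ _ _ ⟨1⟩ ⟨w.val⟩, ResBiset.ext (show (β 1 * w.val : G) = w.val by simp)⟩

theorem res_id_comp [Finite G] [Finite H] (x : Burnside G H) :
    comp (res (MonoidHom.id G)) x = x := by
  refine Burnside.induction
    (p := fun x => comp (res (MonoidHom.id G)) x = x) x ?_ (by simp) ?_ ?_
  rotate_left
  · intro x y hx hy; simp [hx, hy]
  · intro x hx; simp [hx]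
  intro c
  rw [basis_eq c]
  generalize c.out = D
  have : Finite ((G × H) ⧸ D) := Quotient.finite _
  rw [res, comp_bisetClass]
  refine (bisetClass_congr (Tensor.lift (Z := (G × H) ⧸ D)
    (fun v x => ((v.val, 1) : G × H) • x) ?_) ?_ ⟨?_, ?_⟩).symm
  · intro h v x
    simp [ResBiset.smul_val, smul_smul]
  · intro a t
    induction t using Tensor.ind with | _ v x
    change ((a.1 * v.val * 1⁻¹, 1) : G × H) • (((1, a.2) : G × H) • x) =
      a • (((v.val, 1) : G × H) • x)
    rw [smul_smul, smul_smul]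
    congr 1
    ext <;> simp
  · intro s t h
    induction s using Tensor.ind with | _ v x
    induction t using Tensor.ind with | _ v' x'
    have h : ((v.val, 1) : G × H) • x = ((v'.val, 1) : G × H) • x' := h
    refine Tensor.mk_eq.2 ⟨v'.val⁻¹ * v.val, ResBiset.ext ?_, ?_⟩
    · simp [ResBiset.smul_val]
    · have e : ((v'.val⁻¹ * v.val, 1) : G × H) =
          ((v'.val, 1) : G × H)⁻¹ * ((v.val, 1) : G × H) := by
        ext <;> simp
      rw [e, mul_smul, h, inv_smul_smul]
  · intro x
    exact ⟨Tensor.mk _ _ _ ⟨1⟩ x, one_smul (G × H) x⟩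

theorem comp_res_id [Finite G] [Finite H] (x : Burnside G H) :
    comp x (res (MonoidHom.id H)) = x := by
  refine Burnside.induction
    (p := fun x => comp x (res (MonoidHom.id H)) = x) x ?_ (by simp) ?_ ?_
  rotate_left
  · intro x y hx hy; simp [hx, hy]
  · intro x hx; simp [hx]
  intro c
  rw [basis_eq c]
  generalize c.out = D
  have : Finite ((G × H) ⧸ D) := Quotient.finite _
  rw [res, comp_bisetClass]
  refine (bisetClass_congr (Tensor.lift (Z := (G × H) ⧸ D)
    (fun x v => ((1, v.val⁻¹) : G × H) • x) ?_) ?_ ⟨?_, ?_⟩).symm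
  · intro h x v
    simp [ResBiset.smul_val, smul_smul]
  · intro a t
    induction t using Tensor.ind with | _ x v
    change ((1, (1 * v.val * a.2⁻¹)⁻¹) : G × H) • (((a.1, 1) : G × H) • x) =
      a • (((1, v.val⁻¹) : G × H) • x)
    rw [smul_smul, smul_smul]
    congr 1
    ext <;> simp
  · intro s t h
    induction s using Tensor.ind with | _ x v
    induction t using Tensor.ind with | _ x' v'
    have h : ((1, v.val⁻¹) : G × H) • x = ((1, v'.val⁻¹) : G × H) • x' := h
    refine Tensor.mk_eq.2 ⟨v'.val * v.val⁻¹, ?_, ResBiset.ext ?_⟩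
    · have e : ((1, v'.val * v.val⁻¹) : G × H) =
          ((1, v'.val⁻¹) : G × H)⁻¹ * ((1, v.val⁻¹) : G × H) := by
        ext <;> simp
      rw [e, mul_smul, h, inv_smul_smul]
    · simp [ResBiset.smul_val]
  · intro x
    exact ⟨Tensor.mk _ _ _ x ⟨1⟩, show ((1, (1 : H)⁻¹) : G × H) • x = x by
      rw [inv_one]; exact one_smul (G × H) x⟩

end Comp

/-! ### The double Burnside algebra of `P` -/

section Algebra

variable {P : Type*} [Group P]

/-- The double Burnside `ℤ`-algebra of `P`; the product is induced by composition. -/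
noncomputable instance [Finite P] : Ring (Burnside P P) where
  __ := (inferInstance : AddCommGroup (Burnside P P))
  mul x y := comp x y
  one := res (MonoidHom.id P)
  mul_assoc := comp_assoc
  one_mul := res_id_comp
  mul_one := comp_res_id
  left_distrib x y z := map_add (comp x) y z
  right_distrib x y z := by
    change comp (x + y) z = comp x z + comp y z
    simp
  zero_mul x := by
    change comp 0 x = 0
    simp
  mul_zero x := map_zero (comp x)

theorem mul_def [Finite P] (x y : Burnside P P) : x * y = comp x y := rfl

theorem one_def [Finite P] : (1 : Burnside P P) = res (MonoidHom.id P) := rfl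

/-- The map `t`, `f ↦ f°`, exchanging both factors: `(P × P) / D` goes to `(P × P) / D°`, where `D°`
is the image of `D` under the exchange of coordinates. -/
noncomputable def opp : Burnside P P →+ Burnside P P :=
  Burnside.extend fun c =>
    Burnside.ofSubgroup (c.out.map (MulEquiv.prodComm : P × P ≃* P × P).toMonoidHom)

/-- The length `ℓ`, additively extending `ℓ((P × P) / D) = |(P × P) / D| / |P|`. The division is
exact whenever `{1} × P` acts freely on `(P × P) / D`, that is, on the subalgebra of the elements
preserving projective `P`-sets, which contains all Hecke algebras. -/
noncomputable def length : Burnside P P →+ ℤ :=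
  Burnside.extend fun c => ((c.out.index / Nat.card P : ℕ) : ℤ)

/-- `Δ_φ(Q) = {(φ u, u) | u ∈ Q}`. -/
def graph {Q : Subgroup P} (φ : Q →* P) : Subgroup (P × P) := (φ.prod Q.subtype).range

/-- The indecomposable element `f_{Q,φ}`, the class of `(P × P) / Δ_φ(Q)`. -/
noncomputable def indec {Q : Subgroup P} (φ : Q →* P) : Burnside P P :=
  Burnside.ofSubgroup (graph φ)

theorem one_eq_indec [Finite P] :
    (1 : Burnside P P) = indec (Subgroup.topEquiv : (⊤ : Subgroup P) ≃* P).toMonoidHom := by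
  rw [one_def, res, indec, ← bisetClass_quotient]
  refine (bisetClass_congr (Z := ResBiset (MonoidHom.id P)) (fun q => Quotient.liftOn' q
    (fun a => ⟨a.1 * a.2⁻¹⟩) ?_) ?_ ⟨?_, ?_⟩)
  · rintro ⟨a, b⟩ ⟨c, d⟩ h
    rw [QuotientGroup.leftRel_apply] at h
    obtain ⟨⟨u, _⟩, hu⟩ := h
    have h1 : u = a⁻¹ * c := congrArg Prod.fst hu
    have h2 : u = b⁻¹ * d := congrArg Prod.snd hu
    refine ResBiset.ext ?_
    change a * b⁻¹ = c * d⁻¹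
    rw [eq_mul_inv_iff_mul_eq, mul_assoc, ← h2, h1, mul_inv_cancel_left]
  · intro a q
    induction q using Quotient.inductionOn' with | _ b
    refine ResBiset.ext ?_
    change (a.1 * b.1) * (a.2 * b.2)⁻¹ = a.1 * (b.1 * b.2⁻¹) * a.2⁻¹
    simp [mul_assoc]
  · intro q r h
    induction q using Quotient.inductionOn' with | _ a
    induction r using Quotient.inductionOn' with | _ b
    have h : a.1 * a.2⁻¹ = b.1 * b.2⁻¹ := congrArg ResBiset.val h
    refine Quotient.sound' ?_
    rw [QuotientGroup.leftRel_apply]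
    refine ⟨⟨a.1⁻¹ * b.1, trivial⟩, Prod.ext rfl ?_⟩
    change a.1⁻¹ * b.1 = a.2⁻¹ * b.2
    rw [mul_inv_eq_iff_eq_mul] at h
    rw [h]
    simp [mul_assoc]
  · intro v
    exact ⟨Quotient.mk'' (v.val, 1), ResBiset.ext (by change v.val * 1⁻¹ = v.val; simp)⟩

end Algebra

/-! ### Divisible and Frobenius `P`-categories -/

/-- A divisible `P`-category: a subcategory of the category of finite groups whose objects are the
subgroups of `P`, all of whose morphisms are injective, which contains the conjugations by elements
of `P`, and such that, for every `Q`, the category of its morphisms to `Q` is a full subcategory of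
the category of group homomorphisms to `Q`. (The identities are conjugations by `1`.) -/
@[ext]
structure DivisibleCategory (P : Type*) [Group P] where
  /-- The set of morphisms from `Q` to `R`. -/
  hom : ∀ Q R : Subgroup P, Set (Q →* R)
  comp_mem : ∀ {Q R T : Subgroup P} {φ : Q →* R} {ψ : R →* T},
    φ ∈ hom Q R → ψ ∈ hom R T → ψ.comp φ ∈ hom Q T
  conj_mem : ∀ {Q R : Subgroup P} (x : P) (φ : Q →* R),
    (∀ u : Q, (φ u : P) = x * u * x⁻¹) → φ ∈ hom Q R
  injective : ∀ {Q R : Subgroup P} {φ : Q →* R}, φ ∈ hom Q R → Function.Injective φ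
  full : ∀ {Q R T : Subgroup P} {φ : R →* Q} {ψ : T →* Q} {θ : R →* T},
    φ ∈ hom R Q → ψ ∈ hom T Q → ψ.comp θ = φ → θ ∈ hom R T

/-- The Frobenius category of `P`: the morphisms are those induced by conjugations in `P`. -/
def innerCategory (P : Type*) [Group P] : DivisibleCategory P where
  hom Q R := {φ | ∃ x : P, ∀ u : Q, (φ u : P) = x * u * x⁻¹}
  comp_mem := by
    rintro Q R T φ ψ ⟨x, hx⟩ ⟨y, hy⟩
    exact ⟨y * x, fun u => by rw [MonoidHom.comp_apply, hy, hx]; simp [mul_assoc]⟩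
  conj_mem x φ h := ⟨x, h⟩
  injective := by
    rintro Q R φ ⟨x, hx⟩ u v h
    have : x * (u : P) * x⁻¹ = x * v * x⁻¹ := by rw [← hx, ← hx, h]
    exact Subtype.ext (by simpa using this)
  full := by
    rintro Q R T φ ψ θ ⟨x, hx⟩ ⟨y, hy⟩ h
    refine ⟨y⁻¹ * x, fun u => ?_⟩
    have : y * (θ u : P) * y⁻¹ = x * u * x⁻¹ := by rw [← hy, ← hx, ← h]; rfl
    calc (θ u : P) = y⁻¹ * (y * (θ u : P) * y⁻¹) * y := by group
      _ = _ := by rw [this]; group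

namespace DivisibleCategory

variable {P : Type*} [Group P] (F : DivisibleCategory P)

/-- The set `F(P, Q)` of the morphisms from `Q` to `P`. -/
def toP (Q : Subgroup P) : Set (Q →* P) :=
  {φ | (Subgroup.topEquiv : (⊤ : Subgroup P) ≃* P).symm.toMonoidHom.comp φ ∈ F.hom Q ⊤}

/-- The group `F(Q)` of the `F`-automorphisms of `Q`. -/
def aut (Q : Subgroup P) : Subgroup (MulAut Q) where
  carrier := {σ | MulEquiv.toMonoidHom σ ∈ F.hom Q Q}
  mul_mem' := fun {_ _} h h' => F.comp_mem h' h
  one_mem' := F.conj_mem 1 _ (fun u => by simp)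
  inv_mem' := fun {σ} h => F.full (φ := MonoidHom.id Q) (ψ := MulEquiv.toMonoidHom σ)
    (F.conj_mem 1 _ (fun u => by simp)) h (by ext u; simp)

/-- The converse image `N` in `P` of `F_P(Q) ∩ ^{φ*}F_P(φ(Q))`: the elements of `N_P(Q)` whose
conjugation on `Q` corresponds through `φ` to the conjugation on `φ(Q)` by an element of
`N_P(φ(Q))`. -/
def extender {Q : Subgroup P} (φ : Q →* P) : Subgroup P where
  carrier := {u | u ∈ Subgroup.normalizer (Q : Set P) ∧
    ∃ v ∈ Subgroup.normalizer (φ.range : Set P),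
      ∀ x y : Q, (y : P) = u * x * u⁻¹ → φ y = v * φ x * v⁻¹}
  one_mem' := ⟨one_mem _, 1, one_mem _, fun x y h => by
    have : y = x := Subtype.ext (by simpa using h)
    simp [this]⟩
  mul_mem' := by
    rintro a b ⟨ha, v, hv, h⟩ ⟨hb, w, hw, h'⟩
    refine ⟨mul_mem ha hb, v * w, mul_mem hv hw, fun x y hxy => ?_⟩
    rw [h ⟨b * x * b⁻¹, (Subgroup.mem_normalizer_iff.1 hb x).1 x.2⟩ y
      (by simp [hxy, mul_assoc]), h' x _ rfl]
    simp [mul_assoc]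
  inv_mem' := by
    rintro a ⟨ha, v, hv, h⟩
    refine ⟨inv_mem ha, v⁻¹, inv_mem hv, fun x y hxy => ?_⟩
    rw [h y x (by simp [hxy, mul_assoc])]
    simp [mul_assoc]

theorem le_extender {Q : Subgroup P} (φ : Q →* P) : Q ≤ extender φ := fun u hu =>
  ⟨Subgroup.le_normalizer hu, φ ⟨u, hu⟩, Subgroup.le_normalizer ⟨⟨u, hu⟩, rfl⟩, fun x y h => by
    have : y = ⟨u, hu⟩ * x * ⟨u, hu⟩⁻¹ := Subtype.ext (by simpa using h)
    simp [this]⟩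

/-- The condition that `ζ(C_P(φ(Q))) = C_P(ζ(φ(Q)))` for every `F`-morphism `ζ` from
`φ(Q) C_P(φ(Q))` to `P`, stated for a subgroup `T` in place of `φ(Q)`. -/
def FullyCentralized (T : Subgroup P) : Prop :=
  ∀ ζ ∈ F.toP (T ⊔ Subgroup.centralizer (T : Set P)),
    ((Subgroup.centralizer (T : Set P)).subgroupOf (T ⊔ Subgroup.centralizer (T : Set P))).map ζ =
      Subgroup.centralizer
        ((T.subgroupOf (T ⊔ Subgroup.centralizer (T : Set P))).map ζ : Set P)

/-- A divisible `P`-category is a Frobenius `P`-category when `F_P(P)` is a Sylow `p`-subgroup of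
`F(P)` and every `F`-morphism `φ : Q → P` with `φ(Q)` fully centralized extends to an `F`-morphism
from the converse image in `P` of `F_P(Q) ∩ ^{φ*}F_P(φ(Q))`. -/
def IsFrobenius (p : ℕ) : Prop :=
  (∃ S : Sylow p (F.aut ⊤),
    (S : Subgroup (F.aut ⊤)) = ((innerCategory P).aut ⊤).subgroupOf (F.aut ⊤)) ∧
  ∀ (Q : Subgroup P), ∀ φ ∈ F.toP Q, F.FullyCentralized φ.range →
    ∃ ψ ∈ F.toP (extender φ), ψ.comp (Subgroup.inclusion (le_extender φ)) = φ

variable [Finite P]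

theorem indec_mul_indec_mem {Q R : Subgroup P} {φ : Q →* P} {ψ : R →* P}
    (hφ : φ ∈ F.toP Q) (hψ : ψ ∈ F.toP R) :
    indec φ * indec ψ ∈ AddSubgroup.closure
      {x : Burnside P P | ∃ (Q : Subgroup P), ∃ φ ∈ F.toP Q, x = indec φ} := by
  have : Finite ((P × P) ⧸ graph φ) := Quotient.finite _
  have : Finite ((P × P) ⧸ graph ψ) := Quotient.finite _
  rw [mul_def, indec, indec, ← bisetClass_quotient, ← bisetClass_quotient, comp_bisetClass]
  have : Finite (orbitRel.Quotient (P × P)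
    (Tensor P P P ((P × P) ⧸ graph φ) ((P × P) ⧸ graph ψ))) := Quotient.finite _
  have := Fintype.ofFinite (orbitRel.Quotient (P × P)
    (Tensor P P P ((P × P) ⧸ graph φ) ((P × P) ⧸ graph ψ)))
  rw [bisetClass, finsum_eq_sum_of_fintype]
  refine AddSubgroup.sum_mem _ fun o _ => AddSubgroup.subset_closure ?_
  -- every orbit contains a point `[Δ_φ(Q), (w, 1) Δ_ψ(R)]`
  obtain ⟨w, rfl⟩ : ∃ w : P, Quotient.mk (orbitRel (P × P) _)
      (Tensor.mk P P P ((1 : P × P) : (P × P) ⧸ graph φ)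
        (((w, 1) : P × P) : (P × P) ⧸ graph ψ)) = o := by
    induction o using Quotient.inductionOn' with | _ t
    induction t using Tensor.ind with | _ x y
    induction x using Quotient.inductionOn' with | _ a
    induction y using Quotient.inductionOn' with | _ b
    refine ⟨a.2⁻¹ * b.1, Quotient.sound ⟨(a.1⁻¹, b.2⁻¹), ?_⟩⟩
    refine Tensor.mk_eq.2 ⟨a.2⁻¹, ?_, ?_⟩
    · rw [smul_smul]
      refine congrArg (Quotient.mk'' : P × P → (P × P) ⧸ graph φ) ?_
      ext <;> simp
    · rw [smul_smul]
      refine congrArg (Quotient.mk'' : P × P → (P × P) ⧸ graph ψ) ?_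
      ext <;> simp
  let cψ : R →* P := (MulAut.conj w).toMonoidHom.comp ψ
  let U : Subgroup P := (Q.comap cψ).map R.subtype
  have hU : U ≤ R := Subgroup.map_subtype_le _
  have hUQ : ∀ u : U, cψ (Subgroup.inclusion hU u) ∈ Q := by
    rintro ⟨_, ⟨r, hr, rfl⟩⟩
    exact hr
  let θ : U →* Q := (cψ.comp (Subgroup.inclusion hU)).codRestrict Q hUQ
  have hθ : θ ∈ F.hom U Q := by
    let e := (Subgroup.topEquiv : (⊤ : Subgroup P) ≃* P).symm.toMonoidHom
    have h1 : Subgroup.inclusion hU ∈ F.hom U R := F.conj_mem 1 _ fun u => by simp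
    have h2 : e.comp ((MulAut.conj w).toMonoidHom.comp
        (Subgroup.topEquiv : (⊤ : Subgroup P) ≃* P).toMonoidHom) ∈ F.hom ⊤ ⊤ :=
      F.conj_mem w _ fun u => rfl
    have h3 : e.comp Q.subtype ∈ F.hom Q ⊤ := F.conj_mem 1 _ fun u => by
      change (u : P) = _
      simp
    exact F.full (F.comp_mem (F.comp_mem h1 hψ) h2) h3 (by ext u; rfl)
  refine ⟨U, φ.comp θ, F.comp_mem hθ hφ, ?_⟩
  rw [indec, Burnside.ofSubgroup]
  congr 1
  change SubgroupConjClass.mk (stabilizer (P × P) _) = _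
  congr 1
  ext ⟨c, d⟩
  rw [mem_stabilizer_iff, Tensor.smul_mk, eq_comm, Tensor.mk_eq]
  have key1 : ∀ h : P, ((1, h) : P × P) • ((1 : P × P) : (P × P) ⧸ graph φ) =
      ((c, 1) : P × P) • ((1 : P × P) : (P × P) ⧸ graph φ) ↔ (c, h⁻¹) ∈ graph φ := by
    intro h
    rw [Quotient.smul_coe, Quotient.smul_coe, QuotientGroup.eq]
    simp
  have key2 : ∀ h : P, ((h, 1) : P × P) • (((w, 1) : P × P) : (P × P) ⧸ graph ψ) =
      ((1, d) : P × P) • (((w, 1) : P × P) : (P × P) ⧸ graph ψ) ↔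
      (w⁻¹ * h⁻¹ * w, d) ∈ graph ψ := by
    intro h
    rw [Quotient.smul_coe, Quotient.smul_coe, QuotientGroup.eq]
    simp [mul_assoc]
  simp only [key1, key2]
  constructor
  · rintro ⟨h, ⟨q, hq⟩, ⟨r, hr⟩⟩
    have q1 : φ q = c := congrArg Prod.fst hq
    have q2 : (q : P) = h⁻¹ := congrArg Prod.snd hq
    have r1 : ψ r = w⁻¹ * h⁻¹ * w := congrArg Prod.fst hr
    have r2 : (r : P) = d := congrArg Prod.snd hr
    have hc : cψ r = q := by
      change w * ψ r * w⁻¹ = q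
      rw [r1, q2]
      group
    have hr' : r ∈ Q.comap cψ := by
      change cψ r ∈ Q
      rw [hc]; exact q.2
    refine ⟨⟨r, ⟨r, hr', rfl⟩⟩, Prod.ext ?_ r2⟩
    change φ (θ _) = c
    rw [← q1]
    congr 1
    exact Subtype.ext hc
  · rintro ⟨u, hu⟩
    have u1 : φ (θ u) = c := congrArg Prod.fst hu
    have u2 : (u : P) = d := congrArg Prod.snd hu
    refine ⟨((θ u : Q) : P)⁻¹, ⟨θ u, Prod.ext u1 (inv_inv _).symm⟩,
      ⟨Subgroup.inclusion hU u, Prod.ext ?_ u2⟩⟩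
    change ψ (Subgroup.inclusion hU u) =
      w⁻¹ * ((w * ψ (Subgroup.inclusion hU u) * w⁻¹)⁻¹)⁻¹ * w
    group

/-- The Hecke `ℤ`-algebra `H_F` of `F`: the `ℤ`-subalgebra of the double Burnside algebra spanned by
the elements `f_{Q,φ}`, where `φ : Q → P` runs over the `F`-morphisms to `P`. -/
noncomputable def hecke : Subring (Burnside P P) where
  __ := AddSubgroup.closure
    {x : Burnside P P | ∃ (Q : Subgroup P), ∃ φ ∈ F.toP Q, x = indec φ}
  one_mem' := AddSubgroup.subset_closure
    ⟨⊤, _, F.conj_mem 1 _ (fun u => by simp), one_eq_indec⟩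
  mul_mem' := by
    intro x y hx hy
    refine AddSubgroup.closure_induction₂ (p := fun x y _ _ => x * y ∈ AddSubgroup.closure
      {x : Burnside P P | ∃ (Q : Subgroup P), ∃ φ ∈ F.toP Q, x = indec φ})
      ?_ ?_ ?_ ?_ ?_ ?_ ?_ hx hy
    · rintro _ _ ⟨Q, φ, hφ, rfl⟩ ⟨R, ψ, hψ, rfl⟩
      exact F.indec_mul_indec_mem hφ hψ
    · intro x _; rw [zero_mul]; exact zero_mem _
    · intro x _; rw [mul_zero]; exact zero_mem _
    · intro x y z _ _ _ h h'; rw [add_mul]; exact add_mem h h'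
    · intro x y z _ _ _ h h'; rw [mul_add]; exact add_mem h h'
    · intro x y _ _ h; rw [neg_mul]; exact neg_mem h
    · intro x y _ _ h; rw [mul_neg]; exact neg_mem h

/-- The elements `f` of the double Burnside algebra with `res_φ · f = res_{ι_Q} · f` and
`res_φ · f° = res_{ι_Q} · f°` for every subgroup `Q` and every `F`-morphism `φ : Q → P`. -/
noncomputable def invariants : AddSubgroup (Burnside P P) where
  carrier := {f | ∀ (Q : Subgroup P), ∀ φ ∈ F.toP Q,
    comp (res φ) f = comp (res Q.subtype) f ∧ comp (res φ) (opp f) = comp (res Q.subtype) (opp f)}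
  zero_mem' := by intro Q φ _; simp
  add_mem' := by
    intro x y hx hy Q φ hφ
    simp [hx Q φ hφ, hy Q φ hφ]
  neg_mem' := by
    intro x hx Q φ hφ
    simp [hx Q φ hφ]

/-- The invariants `H^F` of the Hecke algebra `H = H_F`. -/
noncomputable def heckeInvariants : AddSubgroup (Burnside P P) :=
  F.hecke.toAddSubgroup ⊓ F.invariants

end DivisibleCategory

section Element

variable {P : Type*} [Group P] [Finite P]

theorem res_conj {Q : Subgroup P} (x : P) (φ : Q →* P) (h : ∀ u, φ u = x * u * x⁻¹) :
    res φ = res Q.subtype := by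
  refine bisetClass_congr (fun v => ⟨x * v.val⟩) ?_ ⟨?_, ?_⟩
  · intro a v
    refine ResBiset.ext ?_
    change x * (a.1 * v.val * a.2⁻¹) = φ a.1 * (x * v.val) * a.2⁻¹
    rw [h]
    group
  · intro v w hvw
    exact ResBiset.ext (mul_left_cancel (congrArg ResBiset.val hvw))
  · intro v
    exact ⟨⟨x⁻¹ * v.val⟩, ResBiset.ext (mul_inv_cancel_left x v.val)⟩

/-- The divisible `P`-category `F^f`: the morphisms from `Q` to `P` are the injective group
homomorphisms `φ` with `res_φ · f = res_{ι_Q} · f` and `res_φ · f° = res_{ι_Q} · f°`, and the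
morphisms from `Q` to `R` are those whose composite with the inclusion of `R` is of this kind. -/
noncomputable def stabilizerCategory (f : Burnside P P) : DivisibleCategory P where
  hom Q R := {φ | Function.Injective φ ∧
    comp (res (R.subtype.comp φ)) f = comp (res Q.subtype) f ∧
    comp (res (R.subtype.comp φ)) (opp f) = comp (res Q.subtype) (opp f)}
  comp_mem := by
    rintro Q R T φ ψ ⟨i, h1, h2⟩ ⟨j, h3, h4⟩
    refine ⟨j.comp i, ?_, ?_⟩
    · rw [← MonoidHom.comp_assoc, ← res_comp, comp_assoc, h3, ← comp_assoc, res_comp, h1]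
    · rw [← MonoidHom.comp_assoc, ← res_comp, comp_assoc, h4, ← comp_assoc, res_comp, h2]
  conj_mem := by
    intro Q R x φ h
    refine ⟨(innerCategory P).injective ⟨x, h⟩, ?_, ?_⟩ <;> rw [res_conj x _ h]
  injective h := h.1
  full := by
    rintro Q R T φ ψ θ ⟨i, h1, h2⟩ ⟨j, h3, h4⟩ rfl
    refine ⟨Function.Injective.of_comp i, ?_, ?_⟩
    · rw [← h1, ← MonoidHom.comp_assoc, ← res_comp, ← res_comp, comp_assoc, comp_assoc, h3]
    · rw [← h2, ← MonoidHom.comp_assoc, ← res_comp, ← res_comp, comp_assoc, comp_assoc, h4]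

/-- The minimal Hecke algebra `H_f` containing `f`: the intersection of all of them. -/
noncomputable def minimalHecke (f : Burnside P P) : Subring (Burnside P P) :=
  sInf {H | (∃ F : DivisibleCategory P, H = F.hecke) ∧ f ∈ H}

end Element

end Puig

namespace Puig

open MulAction QuotientGroup

/-! ### Orbit counting for `p`-groups -/

section Orbits

theorem dvd_card_of_dvd_index {A Z : Type*} [Group A] [MulAction A Z] [Finite Z] (d : ℕ)
    (h : ∀ z : Z, d ∣ (stabilizer A z).index) : d ∣ Nat.card Z := by
  have : Finite (orbitRel.Quotient A Z) := Quotient.finite _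
  have := Fintype.ofFinite (orbitRel.Quotient A Z)
  rw [Nat.card_congr (selfEquivSigmaOrbits A Z), Nat.card_sigma]
  refine Finset.dvd_sum fun o _ => ?_
  have := h (Quotient.out o)
  rwa [index_stabilizer] at this

theorem _root_.Subgroup.card_sup_of_disjoint {A : Type*} [Group A] (S K : Subgroup A) [K.Normal]
    (h : Disjoint S K) : Nat.card (S ⊔ K : Subgroup A) = Nat.card S * Nat.card K := by
  have h1 := Subgroup.relIndex_sup_right S K
  rw [← Subgroup.inf_relIndex_right K S, inf_comm, h.eq_bot, Subgroup.relIndex_bot_left] at h1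
  have h2 := Subgroup.relIndex_mul_relIndex (⊥ : Subgroup A) K (S ⊔ K) bot_le le_sup_right
  rw [h1, Subgroup.relIndex_bot_left, Subgroup.relIndex_bot_left] at h2
  rw [← h2, mul_comm]

theorem _root_.Subgroup.card_mul_index_sup {A : Type*} [Group A] [Finite A] (S K : Subgroup A)
    [K.Normal] (h : Disjoint S K) : Nat.card K * (S ⊔ K).index = S.index := by
  have h1 := (S ⊔ K).card_mul_index
  rw [Subgroup.card_sup_of_disjoint S K h, ← S.card_mul_index, mul_assoc] at h1
  exact Nat.eq_of_mul_eq_mul_left Nat.card_pos h1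

theorem card_dvd_of_disjoint_stabilizer {A Z : Type*} [Group A] [Finite A] [MulAction A Z]
    [Finite Z] (K : Subgroup A) [K.Normal] (hK : ∀ z : Z, Disjoint (stabilizer A z) K) :
    Nat.card K ∣ Nat.card Z :=
  dvd_card_of_dvd_index (A := A) _ fun z =>
    ⟨_, (Subgroup.card_mul_index_sup (stabilizer A z) K (hK z)).symm⟩

/-- If a `p`-group `A` acts on a finite set so that a normal subgroup `K` acts freely, then the
number of points `z` with `A z ≠ K z` is divisible by `p |K|`. -/
theorem mul_card_dvd_of_disjoint_stabilizer {p : ℕ} [Fact p.Prime] {A Z : Type*} [Group A]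
    [Finite A] [MulAction A Z] [Finite Z] (hA : IsPGroup p A) (K : Subgroup A) [K.Normal]
    (hK : ∀ z : Z, Disjoint (stabilizer A z) K) :
    p * Nat.card K ∣ Nat.card {z : Z // ¬ ∀ a : A, ∃ k ∈ K, k • a • z = z} := by
  let B : SubMulAction A Z :=
    { carrier := {z | ¬ ∀ a : A, ∃ k ∈ K, k • a • z = z}
      smul_mem' := by
        intro b z hz h
        refine hz fun a => ?_
        obtain ⟨k, hk, e⟩ := h (b * a * b⁻¹)
        refine ⟨b⁻¹ * k * b, ?_, ?_⟩
        · simpa using ‹K.Normal›.conj_mem k hk b⁻¹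
        · have e' := congrArg (b⁻¹ • ·) e
          simpa [smul_smul, mul_assoc] using e' }
  change _ ∣ Nat.card B
  refine dvd_card_of_dvd_index (A := A) _ fun z => ?_
  have hs : stabilizer A z = stabilizer A (z : Z) := by
    ext a
    rw [mem_stabilizer_iff, mem_stabilizer_iff, ← SubMulAction.val_smul, Subtype.ext_iff]
  rw [hs, ← Subgroup.card_mul_index_sup (stabilizer A (z : Z)) K (hK z), mul_comm]
  refine mul_dvd_mul_left _ ?_
  obtain ⟨n, hn⟩ := hA.index (stabilizer A (z : Z) ⊔ K)
  rw [hn]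
  refine dvd_pow_self p ?_
  rintro rfl
  rw [pow_zero, Subgroup.index_eq_one] at hn
  refine z.2 fun a => ?_
  obtain ⟨s, hs, k, hk, e⟩ := Subgroup.mem_sup_of_normal_right.1
    (show a⁻¹ ∈ stabilizer A (z : Z) ⊔ K by rw [hn]; trivial)
  refine ⟨k, hk, ?_⟩
  have e2 : k * a = s⁻¹ := by
    rw [← inv_inv a, ← e]; group
  rw [smul_smul, e2, inv_smul_eq_iff]
  exact hs.symm

end Orbits

/-! ### Marks -/

section Mark

variable {H G K : Type*} [Group H] [Group G] [Group K]

/-- The mark of a subgroup `D`: the additive extension of the number of fixed points of `D`. -/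
noncomputable def mark (D : Subgroup (H × G)) : Burnside H G →+ ℤ :=
  Burnside.extend fun c => (Nat.card (fixedPoints D ((H × G) ⧸ c.out)) : ℤ)

variable [Finite H] [Finite G] [Finite K]

theorem mark_bisetClass (D : Subgroup (H × G)) (X : Type*) [MulAction (H × G) X] [Finite X] :
    mark D (bisetClass H G X) = Nat.card (fixedPoints D X) := by
  obtain ⟨u, hu, hb⟩ := exists_decomp (H := H) (G := G) X
  have : Finite (orbitRel.Quotient (H × G) X) := Quotient.finite _
  have := Fintype.ofFinite (orbitRel.Quotient (H × G) X)
  have : ∀ o : orbitRel.Quotient (H × G) X, Finite ((H × G) ⧸ (stabClass o).out) :=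
    fun o => Quotient.finite _
  rw [bisetClass, finsum_eq_sum_of_fintype, map_sum]
  simp only [mark, Burnside.extend_basis]
  rw [← Nat.cast_sum, ← Nat.card_sigma]
  congr 1
  refine Nat.card_congr (Equiv.ofBijective
    (fun s => ⟨u s.1 s.2.1, fun d => ?_⟩) ⟨?_, ?_⟩)
  · change (d : H × G) • u _ _ = _
    rw [← hu]
    exact congrArg _ (s.2.2 d)
  · rintro ⟨o, w, hw⟩ ⟨o', w', hw'⟩ h
    have := hb.1 (a₁ := ⟨o, w⟩) (a₂ := ⟨o', w'⟩) (congrArg Subtype.val h)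
    cases this
    rfl
  · rintro ⟨x, hx⟩
    obtain ⟨⟨o, w⟩, rfl⟩ := hb.2 x
    refine ⟨⟨o, w, fun d => ?_⟩, rfl⟩
    have h : (d : H × G) • u o w = u o w := hx d
    rw [← hu] at h
    have := hb.1 (a₁ := ⟨o, (d : H × G) • w⟩) (a₂ := ⟨o, w⟩) h
    exact eq_of_heq (Sigma.mk.inj_iff.1 this).2

theorem mark_comp_res (φ : H →* G) (D : Subgroup (H × K)) (x : Burnside G K) :
    mark D (comp (res φ) x) = mark (D.map (φ.prodMap (MonoidHom.id K))) x := by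
  refine DFunLike.congr_fun (f := (mark D).comp (comp (res φ))) (g := mark _) ?_ x
  refine Burnside.hom_ext fun c => ?_
  rw [AddMonoidHom.comp_apply, basis_eq c]
  generalize c.out = E
  have : Finite ((G × K) ⧸ E) := Quotient.finite _
  rw [res, comp_bisetClass, mark_bisetClass, mark_bisetClass]
  congr 1
  have key : ∀ (d : H × K) (x : (G × K) ⧸ E),
      d • Tensor.mk H G K (⟨1⟩ : ResBiset φ) x = Tensor.mk H G K ⟨1⟩ ((φ d.1, d.2) • x) := by
    intro d x
    rw [Tensor.smul_mk]
    refine Tensor.mk_eq.2 ⟨φ d.1, ResBiset.ext ?_, ?_⟩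
    · simp [ResBiset.smul_val]
    · simp [smul_smul]
  have inj : ∀ x y : (G × K) ⧸ E, Tensor.mk H G K (⟨1⟩ : ResBiset φ) x = Tensor.mk H G K ⟨1⟩ y →
      x = y := by
    intro x y h
    obtain ⟨g, h1, h2⟩ := Tensor.mk_eq.1 h
    have : g = 1 := by simpa [ResBiset.smul_val] using congrArg ResBiset.val h1
    subst this
    rw [← h2]
    exact (one_smul (G × K) x).symm
  refine (Nat.card_congr (Equiv.ofBijective
    (fun x => ⟨Tensor.mk H G K ⟨1⟩ x.1, fun d => (key d.1 x.1).trans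
      (congrArg _ (x.2 ⟨_, ⟨d.1, d.2, rfl⟩⟩))⟩) ⟨?_, ?_⟩)).symm
  · intro x y h
    exact Subtype.ext (inj _ _ (congrArg Subtype.val h))
  · rintro ⟨t, ht⟩
    induction t using Tensor.ind with | _ v x
    have e : Tensor.mk H G K v x = Tensor.mk H G K ⟨1⟩ (((v.val, 1) : G × K) • x) :=
      Tensor.mk_eq.2 ⟨v.val, ResBiset.ext (by simp [ResBiset.smul_val]), rfl⟩
    refine ⟨⟨((v.val, 1) : G × K) • x, ?_⟩, Subtype.ext e.symm⟩
    rintro ⟨_, ⟨d, hd, rfl⟩⟩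
    refine inj _ _ ?_
    rw [← e]
    refine Eq.trans ?_ (ht ⟨d, hd⟩)
    change _ = d • Tensor.mk H G K v x
    rw [e, key]
    rfl

theorem mark_opp {P : Type*} [Group P] [Finite P] (D : Subgroup (P × P)) (x : Burnside P P) :
    mark D (opp x) = mark (D.map (MulEquiv.prodComm : P × P ≃* P × P).toMonoidHom) x := by
  refine DFunLike.congr_fun (f := (mark D).comp opp) (g := mark _) ?_ x
  refine Burnside.hom_ext fun c => ?_
  rw [AddMonoidHom.comp_apply, opp, Burnside.extend_basis, basis_eq c, ← bisetClass_quotient]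
  generalize c.out = E
  set s := (MulEquiv.prodComm : P × P ≃* P × P).toMonoidHom with hs
  have : Finite ((P × P) ⧸ E) := Quotient.finite _
  have : Finite ((P × P) ⧸ E.map s) := Quotient.finite _
  rw [mark_bisetClass, mark_bisetClass]
  congr 1
  let e : (P × P) ⧸ E ≃ (P × P) ⧸ E.map s :=
    Quotient.congr MulEquiv.prodComm.toEquiv fun a b => by
      change leftRel E a b ↔ leftRel (E.map s) (s a) (s b)
      rw [leftRel_apply, leftRel_apply, ← map_inv, ← map_mul,
        Subgroup.mem_map_iff_mem MulEquiv.prodComm.injective]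
  have he : ∀ a x, e (a • x) = s a • e x := by
    intro a x
    induction x using Quotient.inductionOn' with | _ b
    exact congrArg (Quotient.mk'' : P × P → (P × P) ⧸ E.map s) (map_mul s a b)
  have hss : ∀ a, s (s a) = a := fun a => rfl
  refine (Nat.card_congr (e.subtypeEquiv fun x => ?_)).symm
  constructor
  · rintro h ⟨d, hd⟩
    have h1 := h ⟨s d, Subgroup.mem_map_of_mem s hd⟩
    change s d • x = x at h1
    change d • e x = e x
    rw [← hss d, ← he, h1]
  · rintro h ⟨_, ⟨d, hd, rfl⟩⟩
    have h1 : d • e x = e x := h ⟨d, hd⟩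
    rw [← hss d, ← he] at h1
    exact e.injective h1

end Mark

end Puig

namespace Puig

open MulAction QuotientGroup

/-! ### Marks of graphs of homomorphisms -/

section PairMark

variable {P Q : Type*} [Group P] [Finite P] [Group Q]

/-- The mark of the subgroup `{(α u, β u) | u ∈ Q}` of `P × P`. -/
noncomputable def pairMark (α β : Q →* P) : Burnside P P →+ ℤ := mark (α.prod β).range

theorem pairMark_congr_left [Finite Q] {φ ψ : Q →* P} (β : Q →* P) {f : Burnside P P}
    (h : comp (res φ) f = comp (res ψ) f) : pairMark φ β f = pairMark ψ β f := by
  have key : ∀ φ : Q →* P,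
      pairMark φ β f = mark ((MonoidHom.id Q).prod β).range (comp (res φ) f) := by
    intro φ
    rw [mark_comp_res, pairMark, MonoidHom.map_range]
    rfl
  rw [key, key, h]

theorem pairMark_opp (α β : Q →* P) (f : Burnside P P) :
    pairMark α β (opp f) = pairMark β α f := by
  rw [pairMark, mark_opp, pairMark, MonoidHom.map_range]
  rfl

theorem pairMark_congr_right [Finite Q] {φ ψ : Q →* P} (α : Q →* P) {f : Burnside P P}
    (h : comp (res φ) (opp f) = comp (res ψ) (opp f)) : pairMark α φ f = pairMark α ψ f := by
  rw [← pairMark_opp φ, ← pairMark_opp ψ, pairMark_congr_left α h]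

theorem pairMark_comp {R : Type*} [Group R] (α β : Q →* P) (e : R →* Q)
    (he : Function.Surjective e) : pairMark (α.comp e) (β.comp e) = pairMark α β := by
  have : ((α.comp e).prod (β.comp e)).range = (α.prod β).range := by
    change ((α.prod β).comp e).range = _
    rw [MonoidHom.range_comp, MonoidHom.range_eq_top.2 he, MonoidHom.range_eq_map]
  rw [pairMark, pairMark, this]

theorem pairMark_indec (α β : Q →* P) {R : Subgroup P} (σ : R →* P) :
    pairMark α β (indec σ) =
      Nat.card {x : (P × P) ⧸ graph σ // ∀ u, ((α u, β u) : P × P) • x = x} := by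
  have : Finite ((P × P) ⧸ graph σ) := Quotient.finite _
  rw [indec, ← bisetClass_quotient, pairMark, mark_bisetClass]
  congr 1
  refine Nat.card_congr (Equiv.subtypeEquivRight fun x => ⟨fun h u => h ⟨_, ⟨u, rfl⟩⟩, ?_⟩)
  rintro h ⟨_, ⟨u, rfl⟩⟩
  exact h u

end PairMark

variable {P : Type*} [Group P]

theorem exists_smul_eq_iff {R : Subgroup P} (σ : R →* P) (x : (P × P) ⧸ graph σ) :
    ∃ a b : P, ∀ c d : P, ((c, d) : P × P) • x = x ↔
      ∃ r : R, c = a * σ r * a⁻¹ ∧ d = b * r * b⁻¹ := by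
  induction x using Quotient.inductionOn' with | _ y
  refine ⟨y.1, y.2, fun c d => ?_⟩
  rw [eq_comm]
  change (Quotient.mk'' y : (P × P) ⧸ graph σ) = Quotient.mk'' ((c, d) * y) ↔ _
  rw [Quotient.eq'', leftRel_apply]
  constructor
  · rintro ⟨r, hr⟩
    have h1 : σ r = y.1⁻¹ * (c * y.1) := congrArg Prod.fst hr
    have h2 : (r : P) = y.2⁻¹ * (d * y.2) := congrArg Prod.snd hr
    refine ⟨r, ?_, ?_⟩
    · rw [h1]; group
    · rw [h2]; group
  · rintro ⟨r, rfl, rfl⟩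
    refine ⟨r, Prod.ext ?_ ?_⟩
    · change σ r = y.1⁻¹ * (y.1 * σ r * y.1⁻¹ * y.1)
      group
    · change (r : P) = y.2⁻¹ * (y.2 * r * y.2⁻¹ * y.2)
      group

theorem eq_of_smul_eq_left {R : Subgroup P} {σ : R →* P} {x : (P × P) ⧸ graph σ} {c c' d : P}
    (h : ((c, d) : P × P) • x = x) (h' : ((c', d) : P × P) • x = x) : c = c' := by
  obtain ⟨a, b, hab⟩ := exists_smul_eq_iff σ x
  obtain ⟨r, rfl, hr⟩ := (hab _ _).1 h
  obtain ⟨s, rfl, hs⟩ := (hab _ _).1 h'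
  have : r = s := Subtype.ext (by simpa [hr] using hs)
  rw [this]

theorem eq_of_smul_eq_right {R : Subgroup P} {σ : R →* P} (hσ : Function.Injective σ)
    {x : (P × P) ⧸ graph σ} {c d d' : P}
    (h : ((c, d) : P × P) • x = x) (h' : ((c, d') : P × P) • x = x) : d = d' := by
  obtain ⟨a, b, hab⟩ := exists_smul_eq_iff σ x
  obtain ⟨r, hr, rfl⟩ := (hab _ _).1 h
  obtain ⟨s, hs, rfl⟩ := (hab _ _).1 h'
  have : r = s := hσ (by simpa [hr] using hs)
  rw [this]

namespace DivisibleCategory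

variable {F : DivisibleCategory P}

theorem mem_toP_of_conj {Q : Subgroup P} {φ : Q →* P} (x : P) (h : ∀ u : Q, φ u = x * u * x⁻¹) :
    φ ∈ F.toP Q := F.conj_mem x _ h

theorem comp_mem_toP {Q R : Subgroup P} {θ : Q →* R} {σ : R →* P} (hθ : θ ∈ F.hom Q R)
    (hσ : σ ∈ F.toP R) : σ.comp θ ∈ F.toP Q := F.comp_mem (ψ := _) hθ hσ

theorem conj_comp_mem_toP {Q : Subgroup P} {φ : Q →* P} (hφ : φ ∈ F.toP Q) (x : P) :
    (MulAut.conj x).toMonoidHom.comp φ ∈ F.toP Q :=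
  F.comp_mem (ψ := (Subgroup.topEquiv : (⊤ : Subgroup P) ≃* P).symm.toMonoidHom.comp
    ((MulAut.conj x).toMonoidHom.comp (Subgroup.topEquiv : (⊤ : Subgroup P) ≃* P).toMonoidHom))
    hφ (F.conj_mem x _ fun _ => rfl)

theorem mem_hom_of_comp_eq {Q R : Subgroup P} {φ : Q →* P} {ψ : R →* P} {θ : Q →* R}
    (hφ : φ ∈ F.toP Q) (hψ : ψ ∈ F.toP R) (h : ∀ u, ψ (θ u) = φ u) : θ ∈ F.hom Q R :=
  F.full hφ hψ (by ext u; exact h u)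

theorem mem_hom_iff {Q R : Subgroup P} {φ : Q →* R} :
    φ ∈ F.hom Q R ↔ R.subtype.comp φ ∈ F.toP Q :=
  ⟨fun h => comp_mem_toP h (mem_toP_of_conj 1 fun u => by simp),
    fun h => mem_hom_of_comp_eq h (ψ := R.subtype) (mem_toP_of_conj 1 fun u => by simp)
      fun _ => rfl⟩

theorem injective_of_mem_toP {Q : Subgroup P} {φ : Q →* P} (hφ : φ ∈ F.toP Q) :
    Function.Injective φ := fun _ _ h => F.injective hφ (Subtype.ext h)

theorem mem_toP_of_smul_eq_left {R N : Subgroup P} {σ : R →* P} (hσ : σ ∈ F.toP R)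
    {x : (P × P) ⧸ graph σ} {φ : N →* P} (h : ∀ u : N, ((φ u, (u : P)) : P × P) • x = x) :
    φ ∈ F.toP N := by
  obtain ⟨a, b, hab⟩ := exists_smul_eq_iff σ x
  simp only [hab] at h
  have hN : ∀ u : N, ((MulAut.conj b⁻¹).toMonoidHom.comp N.subtype) u ∈ R := by
    intro u
    obtain ⟨r, -, hr⟩ := h u
    have : ((MulAut.conj b⁻¹).toMonoidHom.comp N.subtype) u = r := by
      simp [hr, mul_assoc]
    rw [this]; exact r.2
  let θ : N →* R := ((MulAut.conj b⁻¹).toMonoidHom.comp N.subtype).codRestrict R hN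
  have hθ : θ ∈ F.hom N R := F.conj_mem b⁻¹ _ fun u => rfl
  have e : φ = (MulAut.conj a).toMonoidHom.comp (σ.comp θ) := by
    ext u
    obtain ⟨r, h1, h2⟩ := h u
    have : θ u = r := Subtype.ext (by
      change b⁻¹ * u * b⁻¹⁻¹ = (r : P)
      rw [h2]; group)
    rw [h1, ← this]
    rfl
  rw [e]
  exact conj_comp_mem_toP (comp_mem_toP hθ hσ) a

theorem mem_toP_of_smul_eq_right {R N : Subgroup P} {σ : R →* P} (hσ : σ ∈ F.toP R)
    {x : (P × P) ⧸ graph σ} {ψ : N →* P} (h : ∀ u : N, (((u : P), ψ u) : P × P) • x = x) :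
    ψ ∈ F.toP N := by
  obtain ⟨a, b, hab⟩ := exists_smul_eq_iff σ x
  simp only [hab] at h
  have hN : ∀ u : N, ((MulAut.conj b⁻¹).toMonoidHom.comp ψ) u ∈ R := by
    intro u
    obtain ⟨r, -, hr⟩ := h u
    have : ((MulAut.conj b⁻¹).toMonoidHom.comp ψ) u = r := by
      simp [hr, mul_assoc]
    rw [this]; exact r.2
  let θ : N →* R := ((MulAut.conj b⁻¹).toMonoidHom.comp ψ).codRestrict R hN
  have hr : ∀ u : N, (u : P) = a * σ (θ u) * a⁻¹ := by
    intro u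
    obtain ⟨r, h1, h2⟩ := h u
    have : θ u = r := Subtype.ext (by
      change b⁻¹ * ψ u * b⁻¹⁻¹ = (r : P)
      rw [h2]; group)
    rw [this, ← h1]
  have hθ : θ ∈ F.hom N R := by
    refine mem_hom_of_comp_eq (φ := (MulAut.conj a⁻¹).toMonoidHom.comp N.subtype)
      (mem_toP_of_conj a⁻¹ fun u => rfl) hσ fun u => ?_
    change _ = a⁻¹ * u * a⁻¹⁻¹
    rw [hr u]; group
  have e : ψ = (MulAut.conj b).toMonoidHom.comp (R.subtype.comp θ) := by
    ext u
    change ψ u = b * (b⁻¹ * ψ u * b⁻¹⁻¹) * b⁻¹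
    group
  rw [e]
  exact conj_comp_mem_toP (mem_hom_iff.1 hθ) b

variable [Finite P]

theorem dvd_of_mem_hecke {f : Burnside P P} (hf : f ∈ F.hecke) (d : ℤ) (L : Burnside P P →+ ℤ)
    (h : ∀ (R : Subgroup P), ∀ σ ∈ F.toP R, d ∣ L (indec σ)) : d ∣ L f := by
  refine AddSubgroup.closure_induction (p := fun f _ => d ∣ L f) ?_ ?_ ?_ ?_ hf
  · rintro _ ⟨R, σ, hσ, rfl⟩
    exact h R σ hσ
  · simp
  · intro x y _ _ hx hy
    rw [map_add]
    exact dvd_add hx hy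
  · intro x _ hx
    rw [map_neg]
    exact hx.neg_right

theorem mem_toP_of_pairMark_left {f : Burnside P P} (hf : f ∈ F.hecke) {Q : Subgroup P}
    {φ : Q →* P} (h : pairMark φ Q.subtype f ≠ 0) : φ ∈ F.toP Q := by
  by_contra hφ
  refine h (zero_dvd_iff.1 (dvd_of_mem_hecke hf 0 _ fun R σ hσ => ?_))
  rw [pairMark_indec, zero_dvd_iff, Nat.cast_eq_zero]
  have : IsEmpty {x : (P × P) ⧸ graph σ // ∀ u, ((φ u, Q.subtype u) : P × P) • x = x} :=
    ⟨fun x => hφ (mem_toP_of_smul_eq_left hσ x.2)⟩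
  exact Nat.card_of_isEmpty

theorem mem_toP_of_pairMark_right {f : Burnside P P} (hf : f ∈ F.hecke) {Q : Subgroup P}
    {ψ : Q →* P} (h : pairMark Q.subtype ψ f ≠ 0) : ψ ∈ F.toP Q := by
  by_contra hψ
  refine h (zero_dvd_iff.1 (dvd_of_mem_hecke hf 0 _ fun R σ hσ => ?_))
  rw [pairMark_indec, zero_dvd_iff, Nat.cast_eq_zero]
  have : IsEmpty {x : (P × P) ⧸ graph σ // ∀ u, ((Q.subtype u, ψ u) : P × P) • x = x} :=
    ⟨fun x => hψ (mem_toP_of_smul_eq_right hσ x.2)⟩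
  exact Nat.card_of_isEmpty

end DivisibleCategory

end Puig

namespace Puig

open MulAction QuotientGroup

/-! ### Divisibility of marks and of the length -/

variable {P : Type*} [Group P] [Finite P]

theorem card_mul_length_indec {R : Subgroup P} (σ : R →* P) :
    (Nat.card P : ℤ) * length (indec σ) = Nat.card ((P × P) ⧸ graph σ) := by
  have hout : (SubgroupConjClass.mk (graph σ)).out.index = (graph σ).index := by
    obtain ⟨a, ha⟩ := SubgroupConjClass.mk_eq_mk.1 (SubgroupConjClass.mk_out
      (SubgroupConjClass.mk (graph σ)))
    conv_rhs => rw [ha]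
    exact (Subgroup.index_map_of_bijective (MulAut.conj a).bijective _).symm
  have hcard : Nat.card (graph σ) = Nat.card R :=
    (Nat.card_congr (MonoidHom.ofInjective (f := σ.prod R.subtype) fun x y h =>
      Subtype.ext (congrArg Prod.snd h)).toEquiv).symm
  have hi := (graph σ).card_mul_index
  rw [hcard, Nat.card_prod, ← R.card_mul_index, mul_assoc, R.card_mul_index] at hi
  have hi := Nat.eq_of_mul_eq_mul_left Nat.card_pos hi
  rw [indec, Burnside.ofSubgroup, length, Burnside.extend_basis, hout, ← Nat.cast_mul,
    Nat.mul_div_cancel' ⟨R.index, by rw [hi, mul_comm]⟩]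
  rfl

namespace DivisibleCategory

variable {F : DivisibleCategory P} {p : ℕ} [Fact p.Prime]

theorem isPGroup_prod (hP : IsPGroup p P) : IsPGroup p (P × P) := by
  obtain ⟨n, hn⟩ := hP.exists_card_eq
  exact IsPGroup.of_card (n := n + n) (by rw [Nat.card_prod, hn, pow_add])

theorem dvd_sum_pairMark_sub_length (hP : IsPGroup p P) {f : Burnside P P} (hf : f ∈ F.hecke)
    (Q : Subgroup P) [Fintype (Q →* P)] :
    ((p * Nat.card P : ℕ) : ℤ) ∣
      ∑ ψ : Q →* P, pairMark Q.subtype ψ f - Nat.card P * length f := by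
  have h := dvd_of_mem_hecke hf ((p * Nat.card P : ℕ) : ℤ)
    (∑ ψ : Q →* P, pairMark Q.subtype ψ - (Nat.card P : ℤ) • length) ?_
  · simpa using h
  intro R σ hσ
  have hX : Finite ((P × P) ⧸ graph σ) := Quotient.finite _
  let A : Subgroup (P × P) := Q.prod ⊤
  let K : Subgroup A := ((⊥ : Subgroup P).prod ⊤).subgroupOf A
  have hK : K.Normal := inferInstance
  have hcard : Nat.card K = Nat.card P := by
    have hle : (⊥ : Subgroup P).prod ⊤ ≤ A := Subgroup.prod_mono bot_le le_rfl
    rw [Nat.card_congr (Subgroup.subgroupOfEquivOfLe hle).toEquiv,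
      Nat.card_congr (Subgroup.prodEquiv _ _).toEquiv]
    simp
  have hfree : ∀ x : (P × P) ⧸ graph σ, Disjoint (stabilizer A x) K := by
    intro x
    rw [Subgroup.disjoint_def]
    rintro ⟨⟨c, d⟩, h⟩ h1 h2
    have hc : c = 1 := h2.1
    subst hc
    have hd : d = 1 := eq_of_smul_eq_right (injective_of_mem_toP hσ)
      (show ((1, d) : P × P) • x = x from h1) (one_smul (P × P) x)
    subst hd
    rfl
  have hbad := mul_card_dvd_of_disjoint_stabilizer
    ((isPGroup_prod hP).to_subgroup A) K hfree
  rw [hcard] at hbad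
  have hgood : ∑ ψ : Q →* P, pairMark Q.subtype ψ (indec σ) =
      Nat.card {x : (P × P) ⧸ graph σ // ∀ a : A, ∃ k ∈ K, k • a • x = x} := by
    simp only [pairMark_indec]
    rw [← Nat.cast_sum, ← Nat.card_sigma]
    congr 1
    refine Nat.card_congr (Equiv.ofBijective (fun s => ⟨s.2.1, ?_⟩) ⟨?_, ?_⟩)
    · obtain ⟨ψ, x, hx⟩ := s
      rintro ⟨⟨u, w⟩, hu, hw⟩
      refine ⟨⟨(1, ψ ⟨u, hu⟩ * w⁻¹), Q.one_mem, trivial⟩, ⟨rfl, trivial⟩, ?_⟩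
      refine Eq.trans ?_ (hx ⟨u, hu⟩)
      change ((1, ψ ⟨u, hu⟩ * w⁻¹) : P × P) • ((u, w) : P × P) • x = _
      rw [smul_smul]
      simp
    · rintro ⟨ψ, x, hx⟩ ⟨ψ', x', hx'⟩ h
      have h : x = x' := congrArg Subtype.val h
      subst h
      have : ψ = ψ' := MonoidHom.ext fun u =>
        eq_of_smul_eq_right (injective_of_mem_toP hσ) (hx u) (hx' u)
      subst this
      rfl
    · rintro ⟨x, hx⟩
      have hex : ∀ u : Q, ∃ v : P, (((u : P), v) : P × P) • x = x := by
        intro u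
        obtain ⟨⟨⟨c, d⟩, _⟩, ⟨hc, -⟩, h⟩ := hx ⟨(u, 1), u.2, trivial⟩
        have hc : c = 1 := hc
        subst hc
        refine ⟨d, ?_⟩
        have h : ((1, d) : P × P) • (((u : P), 1) : P × P) • x = x := h
        rw [smul_smul] at h
        simpa using h
      choose v hv using hex
      have hu : ∀ u w, ((((u : Q) : P), w) : P × P) • x = x → v u = w := fun u w h =>
        eq_of_smul_eq_right (injective_of_mem_toP hσ) (hv u) h
      let ψ : Q →* P :=
        { toFun := v
          map_one' := hu _ _ (one_smul (P × P) x)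
          map_mul' := fun a b => hu _ _ (by
            have e : (((a * b : Q) : P), v a * v b) = (((a : P), v a) : P × P) * ((b : P), v b) :=
              rfl
            rw [e, mul_smul, hv, hv]) }
      exact ⟨⟨ψ, x, hv⟩, rfl⟩
  have hsplit : Nat.card ((P × P) ⧸ graph σ) =
      Nat.card {x : (P × P) ⧸ graph σ // ∀ a : A, ∃ k ∈ K, k • a • x = x} +
      Nat.card {x : (P × P) ⧸ graph σ // ¬ ∀ a : A, ∃ k ∈ K, k • a • x = x} := by
    classical
    rw [← Nat.card_sum]
    exact Nat.card_congr (Equiv.sumCompl _).symm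
  have e : (∑ ψ : Q →* P, pairMark Q.subtype ψ - (Nat.card P : ℤ) • length :
        Burnside P P →+ ℤ) (indec σ) =
      -(Nat.card {x : (P × P) ⧸ graph σ // ¬ ∀ a : A, ∃ k ∈ K, k • a • x = x} : ℤ) := by
    have e1 : (∑ ψ : Q →* P, pairMark Q.subtype ψ - (Nat.card P : ℤ) • length :
        Burnside P P →+ ℤ) (indec σ) =
      ∑ ψ : Q →* P, pairMark Q.subtype ψ (indec σ) - Nat.card P * length (indec σ) := by simp
    rw [e1, hgood, card_mul_length_indec, hsplit]
    push_cast
    ring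
  rw [e]
  exact (Int.natCast_dvd_natCast.2 hbad).neg_right


end DivisibleCategory

theorem mem_normalizer_graph_iff {Q : Subgroup P} {φ : Q →* P} {v u : P} :
    ((v, u) : P × P) ∈ Subgroup.normalizer (graph φ : Set (P × P)) ↔
      ∀ x : Q, ∃ y : Q, (y : P) = u * x * u⁻¹ ∧ φ y = v * φ x * v⁻¹ := by
  constructor
  · intro h x
    obtain ⟨y, hy⟩ := (Subgroup.mem_normalizer_iff.1 h (φ x, (x : P))).1 ⟨x, rfl⟩
    exact ⟨y, congrArg Prod.snd hy, congrArg Prod.fst hy⟩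
  · intro h
    refine Subgroup.mem_normalizer_fintype ?_
    rintro _ ⟨x, rfl⟩
    obtain ⟨y, h1, h2⟩ := h x
    exact ⟨y, Prod.ext h2 h1⟩

namespace DivisibleCategory

variable {F : DivisibleCategory P} {p : ℕ} [Fact p.Prime]

theorem exists_mem_normalizer_graph {Q : Subgroup P} {φ : Q →* P} {u : P}
    (hu : u ∈ extender φ) : ∃ v, ((v, u) : P × P) ∈ Subgroup.normalizer (graph φ : Set (P × P)) := by
  obtain ⟨hN, v, -, h⟩ := hu
  exact ⟨v, mem_normalizer_graph_iff.2 fun x =>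
    ⟨⟨u * x * u⁻¹, (Subgroup.mem_normalizer_iff.1 hN x).1 x.2⟩, rfl, h _ _ rfl⟩⟩

theorem card_centralizer_dvd_pairMark_indec (hP : IsPGroup p P) {Q R : Subgroup P} (φ : Q →* P)
    {σ : R →* P} (hσ : σ ∈ F.toP R) :
    (Nat.card (Subgroup.centralizer (φ.range : Set P)) : ℤ) ∣
      pairMark φ Q.subtype (indec σ) ∧
    ((∀ ψ ∈ F.toP (extender φ), ψ.comp (Subgroup.inclusion (le_extender φ)) ≠ φ) →
      ((p * Nat.card (Subgroup.centralizer (φ.range : Set P)) : ℕ) : ℤ) ∣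
        pairMark φ Q.subtype (indec σ)) := by
  have hX : Finite ((P × P) ⧸ graph σ) := Quotient.finite _
  let A : Subgroup (P × P) := Subgroup.normalizer (graph φ : Set (P × P))
  let K : Subgroup A := ((⊤ : Subgroup P).prod ⊥).subgroupOf A
  have hK : K.Normal := inferInstance
  have hC : ∀ v : P, ((v, 1) : P × P) ∈ A ↔ v ∈ Subgroup.centralizer (φ.range : Set P) := by
    intro v
    rw [mem_normalizer_graph_iff, Subgroup.mem_centralizer_iff]
    constructor
    · rintro h _ ⟨x, rfl⟩
      obtain ⟨y, h1, h2⟩ := h x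
      have : y = x := Subtype.ext (by simpa using h1)
      rw [this] at h2
      nth_rewrite 1 [h2]
      group
    · intro h x
      refine ⟨x, by simp, ?_⟩
      rw [← h (φ x) ⟨x, rfl⟩]
      group
  have hcard : Nat.card K = Nat.card (Subgroup.centralizer (φ.range : Set P)) := by
    refine (Nat.card_congr (Equiv.ofBijective
      (fun v => ⟨⟨(v, 1), (hC v).2 v.2⟩, ⟨trivial, rfl⟩⟩) ⟨?_, ?_⟩)).symm
    · intro v w h
      exact Subtype.ext (congrArg (fun k : K => (k : P × P).1) h)
    · rintro ⟨⟨⟨v, w⟩, h⟩, ⟨h1, h2⟩⟩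
      have h2 : w = 1 := h2
      subst h2
      exact ⟨⟨v, (hC v).1 h⟩, rfl⟩
  let Z : SubMulAction A ((P × P) ⧸ graph σ) :=
    { carrier := {x | ∀ u : Q, ((φ u, (u : P)) : P × P) • x = x}
      smul_mem' := by
        intro a x hx u
        obtain ⟨y, h1, h2⟩ := mem_normalizer_graph_iff.1 (inv_mem a.2) u
        have e : ((φ u, (u : P)) : P × P) * (a : P × P) = (a : P × P) * (φ y, (y : P)) := by
          rw [h1, h2]
          refine Prod.ext ?_ ?_
          · change φ u * (a : P × P).1 = (a : P × P).1 * ((a : P × P).1⁻¹ * _ * (a : P × P).1⁻¹⁻¹)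
            group
          · change (u : P) * (a : P × P).2 =
              (a : P × P).2 * ((a : P × P).2⁻¹ * _ * (a : P × P).2⁻¹⁻¹)
            group
        change _ • (a : P × P) • x = (a : P × P) • x
        rw [smul_smul, e, mul_smul, hx] }
  have hfree : ∀ x : Z, Disjoint (stabilizer A x) K := by
    intro x
    rw [Subgroup.disjoint_def]
    rintro ⟨⟨c, d⟩, h⟩ h1 h2
    have hd : d = 1 := h2.2
    subst hd
    have hc : c = 1 := eq_of_smul_eq_left
      (show ((c, 1) : P × P) • (x : (P × P) ⧸ graph σ) = x from congrArg Subtype.val h1)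
      (one_smul (P × P) _)
    subst hc
    rfl
  have hmark : pairMark φ Q.subtype (indec σ) = Nat.card Z := pairMark_indec _ _ _
  rw [hmark, ← hcard, Int.natCast_dvd_natCast, Int.natCast_dvd_natCast]
  refine ⟨card_dvd_of_disjoint_stabilizer K hfree, fun hno => ?_⟩
  have hbad := mul_card_dvd_of_disjoint_stabilizer ((isPGroup_prod hP).to_subgroup A) K hfree
  have hall : ∀ x : Z, ¬ ∀ a : A, ∃ k ∈ K, k • a • x = x := by
    rintro ⟨x, hxQ⟩ hx
    have hex : ∀ u : extender φ, ∃ v : P, ((v, (u : P)) : P × P) • x = x := by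
      intro u
      obtain ⟨v, hv⟩ := exists_mem_normalizer_graph u.2
      obtain ⟨⟨⟨c, d⟩, _⟩, ⟨-, hd⟩, h⟩ := hx ⟨(v, u), hv⟩
      have hd : d = 1 := hd
      subst hd
      refine ⟨c * v, ?_⟩
      have h : ((c, 1) : P × P) • ((v, (u : P)) : P × P) • x = x := congrArg Subtype.val h
      rw [smul_smul] at h
      simpa using h
    choose v hv using hex
    have hu : ∀ u w, ((w, ((u : extender φ) : P)) : P × P) • x = x → v u = w := fun u w h =>
      eq_of_smul_eq_left (hv u) h
    let ψ : extender φ →* P :=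
      { toFun := v
        map_one' := hu _ _ (one_smul (P × P) x)
        map_mul' := fun a b => hu _ _ (by
          have e : (v a * v b, ((a * b : extender φ) : P)) =
              ((v a, (a : P)) : P × P) * (v b, (b : P)) := rfl
          rw [e, mul_smul, hv, hv]) }
    refine hno ψ (mem_toP_of_smul_eq_left hσ hv) (MonoidHom.ext fun q => ?_)
    exact hu (Subgroup.inclusion (le_extender φ) q) (φ q) (hxQ q)
  rwa [Nat.card_congr (Equiv.subtypeUnivEquiv hall)] at hbad

theorem card_centralizer_dvd_pairMark (hP : IsPGroup p P) {f : Burnside P P} (hf : f ∈ F.hecke)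
    {Q : Subgroup P} (φ : Q →* P) :
    (Nat.card (Subgroup.centralizer (φ.range : Set P)) : ℤ) ∣ pairMark φ Q.subtype f :=
  dvd_of_mem_hecke hf _ _ fun _ _ hσ => (card_centralizer_dvd_pairMark_indec hP φ hσ).1

/-- If the mark of `φ` is not divisible by `p |C_P(φ(Q))|`, then `φ` extends. -/
theorem exists_extension (hP : IsPGroup p P) {f : Burnside P P} (hf : f ∈ F.hecke)
    {Q : Subgroup P} (φ : Q →* P)
    (h : ¬ ((p * Nat.card (Subgroup.centralizer (φ.range : Set P)) : ℕ) : ℤ) ∣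
      pairMark φ Q.subtype f) :
    ∃ ψ ∈ F.toP (extender φ), ψ.comp (Subgroup.inclusion (le_extender φ)) = φ := by
  by_contra! hno
  exact h (dvd_of_mem_hecke hf _ _ fun _ _ hσ =>
    (card_centralizer_dvd_pairMark_indec hP φ hσ).2 hno)

end DivisibleCategory

end Puig

namespace Puig

open MulAction QuotientGroup

/-! ### Invariant elements of length prime to `p` -/

namespace DivisibleCategory

variable {P : Type*} [Group P] {F : DivisibleCategory P} {p : ℕ} [Fact p.Prime]

/-- The group `P` acts on `F(P, Q)` by composition with conjugations. -/
abbrev conjAction (F : DivisibleCategory P) (Q : Subgroup P) : MulAction P (F.toP Q) where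
  smul x φ := ⟨(MulAut.conj x).toMonoidHom.comp φ, conj_comp_mem_toP φ.2 x⟩
  one_smul φ := Subtype.ext (MonoidHom.ext fun u => by
    change 1 * (φ : Q →* P) u * 1⁻¹ = _
    simp)
  mul_smul x y φ := Subtype.ext (MonoidHom.ext fun u => by
    change x * y * (φ : Q →* P) u * (x * y)⁻¹ = x * (y * (φ : Q →* P) u * y⁻¹) * x⁻¹
    group)

theorem stabilizer_conjAction (Q : Subgroup P) (φ : F.toP Q) :
    @stabilizer P _ _ (F.conjAction Q) φ =
      Subgroup.centralizer ((φ : Q →* P).range : Set P) := by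
  let _ := F.conjAction Q
  ext x
  rw [mem_stabilizer_iff, Subgroup.mem_centralizer_iff]
  constructor
  · rintro h _ ⟨u, rfl⟩
    have h1 : x * (φ : Q →* P) u * x⁻¹ = (φ : Q →* P) u :=
      DFunLike.congr_fun (congrArg Subtype.val h) u
    exact (mul_inv_eq_iff_eq_mul.1 h1).symm
  · intro h
    refine Subtype.ext (MonoidHom.ext fun u => ?_)
    exact mul_inv_eq_iff_eq_mul.2 (h _ ⟨u, rfl⟩).symm

theorem card_innerCategory_aut_top : Nat.card ((innerCategory P).aut ⊤) *
    Nat.card (Subgroup.centralizer ((⊤ : Subgroup P).subtype.range : Set P)) = Nat.card P := by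
  let c : P →* MulAut (⊤ : Subgroup P) :=
    MulAut.conj.comp (Subgroup.topEquiv : (⊤ : Subgroup P) ≃* P).symm.toMonoidHom
  have hr : (innerCategory P).aut ⊤ = c.range := by
    ext σ
    constructor
    · rintro ⟨x, hx⟩
      exact ⟨x, MulEquiv.ext fun u => Subtype.ext (hx u).symm⟩
    · rintro ⟨x, rfl⟩
      exact ⟨x, fun u => rfl⟩
  have hk : Subgroup.centralizer ((⊤ : Subgroup P).subtype.range : Set P) = c.ker := by
    ext x
    rw [Subgroup.mem_centralizer_iff, MonoidHom.mem_ker]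
    constructor
    · intro h
      refine MulEquiv.ext fun u => Subtype.ext ?_
      exact mul_inv_eq_iff_eq_mul.2 (h u ⟨u, rfl⟩).symm
    · rintro h _ ⟨u, rfl⟩
      have h1 : x * (u : P) * x⁻¹ = u := congrArg Subtype.val (DFunLike.congr_fun h u)
      exact (mul_inv_eq_iff_eq_mul.1 h1).symm
  rw [hr, hk, ← Subgroup.index_ker, mul_comm, Subgroup.card_mul_index]

variable [Finite P]

theorem pairMark_left_eq {f : Burnside P P} (hf : f ∈ F.invariants) {Q : Subgroup P}
    {φ : Q →* P} (hφ : φ ∈ F.toP Q) (β : Q →* P) :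
    pairMark φ β f = pairMark Q.subtype β f := pairMark_congr_left β (hf Q φ hφ).1

theorem pairMark_right_eq {f : Burnside P P} (hf : f ∈ F.invariants) {Q : Subgroup P}
    {ψ : Q →* P} (hψ : ψ ∈ F.toP Q) (α : Q →* P) :
    pairMark α ψ f = pairMark α Q.subtype f := pairMark_congr_right α (hf Q ψ hψ).2

theorem not_dvd_card_mul_pairMark (hP : IsPGroup p P) {f : Burnside P P}
    (hf : f ∈ F.heckeInvariants) (hlen : IsCoprime (length f) (p : ℤ)) (Q : Subgroup P) :
    ¬ ((p * Nat.card P : ℕ) : ℤ) ∣ Nat.card (F.toP Q) * pairMark Q.subtype Q.subtype f := by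
  classical
  have : Finite (Q →* P) := DFunLike.finite _
  have := Fintype.ofFinite (Q →* P)
  have hsum : ∑ ψ : Q →* P, pairMark Q.subtype ψ f =
      Nat.card (F.toP Q) * pairMark Q.subtype Q.subtype f := by
    have h : ∀ ψ : Q →* P, pairMark Q.subtype ψ f =
        if ψ ∈ F.toP Q then pairMark Q.subtype Q.subtype f else 0 := by
      intro ψ
      split_ifs with hψ
      · exact pairMark_right_eq hf.2 hψ _
      · by_contra h
        exact hψ (mem_toP_of_pairMark_right hf.1 h)
    rw [Finset.sum_congr rfl fun ψ _ => h ψ, ← Finset.sum_filter, Finset.sum_const, nsmul_eq_mul,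
      Nat.card_eq_fintype_card, Fintype.card_subtype]
  intro h
  have h1 := (dvd_sub_right (hsum ▸ h)).1 (dvd_sum_pairMark_sub_length hP hf.1 Q)
  rw [mul_comm p, Nat.cast_mul] at h1
  have h2 := (mul_dvd_mul_iff_left (by exact_mod_cast (Nat.card_pos (α := P)).ne')).1 h1
  have h3 := Int.isUnit_iff.1 (hlen.isUnit_of_dvd' h2 dvd_rfl)
  have := (Fact.out : p.Prime).two_le
  omega

theorem pairMark_ne_zero (hP : IsPGroup p P) {f : Burnside P P}
    (hf : f ∈ F.heckeInvariants) (hlen : IsCoprime (length f) (p : ℤ)) (Q : Subgroup P) :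
    pairMark Q.subtype Q.subtype f ≠ 0 := fun h =>
  not_dvd_card_mul_pairMark hP hf hlen Q (by rw [h, mul_zero]; exact dvd_zero _)

theorem toP_subset_of_mem_hecke (hP : IsPGroup p P) {f : Burnside P P}
    (hf : f ∈ F.heckeInvariants) (hlen : IsCoprime (length f) (p : ℤ))
    {F' : DivisibleCategory P} (hf' : f ∈ F'.hecke) (Q : Subgroup P) : F.toP Q ⊆ F'.toP Q :=
  fun φ hφ => mem_toP_of_pairMark_left hf' (by
    rw [pairMark_left_eq hf.2 hφ]
    exact pairMark_ne_zero hP hf hlen Q)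

theorem minimalHecke_eq (hP : IsPGroup p P) {f : Burnside P P}
    (hf : f ∈ F.heckeInvariants) (hlen : IsCoprime (length f) (p : ℤ)) :
    minimalHecke f = F.hecke := by
  refine le_antisymm (sInf_le ⟨⟨F, rfl⟩, hf.1⟩) (le_sInf ?_)
  rintro _ ⟨⟨F', rfl⟩, hf'⟩
  refine AddSubgroup.closure_mono ?_
  rintro _ ⟨Q, φ, hφ, rfl⟩
  exact ⟨Q, φ, toP_subset_of_mem_hecke hP hf hlen hf' Q hφ, rfl⟩

theorem stabilizerCategory_eq (hP : IsPGroup p P) {f : Burnside P P}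
    (hf : f ∈ F.heckeInvariants) (hlen : IsCoprime (length f) (p : ℤ)) :
    stabilizerCategory f = F := by
  refine DivisibleCategory.ext ?_
  funext Q R
  ext φ
  constructor
  · rintro ⟨-, h, -⟩
    refine mem_hom_iff.2 (mem_toP_of_pairMark_left hf.1 ?_)
    rw [pairMark_congr_left _ h]
    exact pairMark_ne_zero hP hf hlen Q
  · intro hφ
    exact ⟨F.injective hφ, hf.2 Q _ (mem_hom_iff.1 hφ)⟩

/-- Some `F`-morphism `ζ : Q → P` satisfies that `p |C_P(ζ(Q))|` does not divide the mark. -/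
theorem exists_not_dvd_pairMark (hP : IsPGroup p P) {f : Burnside P P}
    (hf : f ∈ F.heckeInvariants) (hlen : IsCoprime (length f) (p : ℤ)) (Q : Subgroup P) :
    ∃ ζ ∈ F.toP Q, ¬ ((p * Nat.card (Subgroup.centralizer (ζ.range : Set P)) : ℕ) : ℤ) ∣
      pairMark Q.subtype Q.subtype f := by
  have : Finite (Q →* P) := DFunLike.finite _
  have : Nonempty (F.toP Q) := ⟨⟨Q.subtype, mem_toP_of_conj 1 fun u => by simp⟩⟩
  obtain ⟨ζ, hζ⟩ := Finite.exists_max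
    fun φ : F.toP Q => Nat.card (Subgroup.centralizer ((φ : Q →* P).range : Set P))
  refine ⟨ζ, ζ.2, fun hd => not_dvd_card_mul_pairMark hP hf hlen Q ?_⟩
  set C := Subgroup.centralizer ((ζ : Q →* P).range : Set P)
  let _ := F.conjAction Q
  have h1 : C.index ∣ Nat.card (F.toP Q) := by
    refine dvd_card_of_dvd_index (A := P) _ fun φ => ?_
    rw [stabilizer_conjAction]
    have h := hζ φ
    set D := Subgroup.centralizer ((φ : Q →* P).range : Set P)
    obtain ⟨m, hm⟩ := hP.index C
    obtain ⟨n, hn⟩ := hP.index D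
    have hle : C.index ≤ D.index := by
      have e := C.card_mul_index.trans D.card_mul_index.symm
      have hpos : 0 < Nat.card C := Nat.card_pos
      by_contra! hlt
      have := Nat.mul_lt_mul_of_le_of_lt h hlt hpos
      omega
    rw [hm, hn] at hle ⊢
    exact pow_dvd_pow p ((Nat.pow_le_pow_iff_right (Fact.out : p.Prime).one_lt).1 hle)
  rw [← C.card_mul_index, ← mul_assoc, mul_comm (p * _), Nat.cast_mul]
  exact mul_dvd_mul (Int.natCast_dvd_natCast.2 h1) hd

theorem pairMark_range_eq {f : Burnside P P} (hf : f ∈ F.invariants) {Q : Subgroup P}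
    {φ : Q →* P} (hφ : φ ∈ F.toP Q) :
    pairMark φ.range.subtype φ.range.subtype f = pairMark φ Q.subtype f := by
  rw [← pairMark_comp φ.range.subtype φ.range.subtype φ.rangeRestrict
    φ.rangeRestrict_surjective]
  exact pairMark_right_eq hf hφ φ

theorem exists_extension_of_fullyCentralized (hP : IsPGroup p P) {f : Burnside P P}
    (hf : f ∈ F.heckeInvariants) (hlen : IsCoprime (length f) (p : ℤ)) {Q : Subgroup P}
    {φ : Q →* P} (hφ : φ ∈ F.toP Q) (hc : F.FullyCentralized φ.range) :
    ∃ ψ ∈ F.toP (extender φ), ψ.comp (Subgroup.inclusion (le_extender φ)) = φ := by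
  refine exists_extension hP hf.1 φ ?_
  rw [← pairMark_range_eq hf.2 hφ]
  set T := φ.range
  obtain ⟨ζ, hζ, hnd⟩ := exists_not_dvd_pairMark hP hf hlen T
  rw [← pairMark_left_eq hf.2 hζ] at hnd
  obtain ⟨ψ, hψ, hext⟩ := exists_extension hP hf.1 ζ hnd
  rw [pairMark_left_eq hf.2 hζ] at hnd
  have hle : T ⊔ Subgroup.centralizer (T : Set P) ≤ extender ζ := by
    refine sup_le (le_extender ζ) fun u hu => ?_
    have hu' : ∀ x ∈ T, u * x * u⁻¹ = x := fun x hx =>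
      mul_inv_eq_iff_eq_mul.2 (Subgroup.mem_centralizer_iff.1 hu x hx).symm
    refine ⟨Subgroup.centralizer_le_normalizer _ hu, 1, one_mem _, fun x y h => ?_⟩
    have : y = x := Subtype.ext (h.trans (hu' x x.2))
    simp [this]
  have h := hc (ψ.comp (Subgroup.inclusion hle))
    (comp_mem_toP (F.conj_mem 1 _ fun u => by simp) hψ)
  have hT : (T.subgroupOf (T ⊔ Subgroup.centralizer (T : Set P))).map
      (ψ.comp (Subgroup.inclusion hle)) = ζ.range := by
    ext y
    constructor
    · rintro ⟨t, ht, rfl⟩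
      exact ⟨⟨t, ht⟩, (DFunLike.congr_fun hext ⟨t, ht⟩).symm⟩
    · rintro ⟨t, rfl⟩
      exact ⟨⟨t, le_sup_left (a := T) t.2⟩, t.2, DFunLike.congr_fun hext t⟩
  rw [hT] at h
  have hcard : Nat.card (Subgroup.centralizer (ζ.range : Set P)) =
      Nat.card (Subgroup.centralizer (T : Set P)) := by
    rw [← h, Subgroup.card_map_of_injective,
      Nat.card_congr (Subgroup.subgroupOfEquivOfLe le_sup_right).toEquiv]
    exact (injective_of_mem_toP hψ).comp (Subgroup.inclusion_injective hle)
  rwa [hcard] at hnd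

theorem card_toP_top : Nat.card (F.toP ⊤) = Nat.card (F.aut ⊤) := by
  refine (Nat.card_congr (Equiv.ofBijective
    (fun σ => ⟨(Subgroup.subtype ⊤).comp (MulEquiv.toMonoidHom (σ : MulAut (⊤ : Subgroup P))),
      mem_hom_iff.1 σ.2⟩) ⟨?_, ?_⟩)).symm
  · intro σ τ h
    refine Subtype.ext (MulEquiv.ext fun u => Subtype.ext ?_)
    exact DFunLike.congr_fun (congrArg Subtype.val h) u
  · rintro ⟨φ, hφ⟩
    let e : (⊤ : Subgroup P) →* (⊤ : Subgroup P) :=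
      (Subgroup.topEquiv : (⊤ : Subgroup P) ≃* P).symm.toMonoidHom.comp φ
    have he : Function.Injective e := F.injective hφ
    exact ⟨⟨MulEquiv.ofBijective e (Finite.injective_iff_bijective.1 he), hφ⟩, rfl⟩

theorem exists_sylow_eq_inner (hP : IsPGroup p P) {f : Burnside P P}
    (hf : f ∈ F.heckeInvariants) (hlen : IsCoprime (length f) (p : ℤ)) :
    ∃ S : Sylow p (F.aut ⊤),
      (S : Subgroup (F.aut ⊤)) = ((innerCategory P).aut ⊤).subgroupOf (F.aut ⊤) := by
  have hle : (innerCategory P).aut ⊤ ≤ F.aut ⊤ := by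
    rintro σ ⟨x, hx⟩
    exact F.conj_mem x _ hx
  set I := ((innerCategory P).aut ⊤).subgroupOf (F.aut ⊤) with hI
  have hcard : Nat.card I = Nat.card ((innerCategory P).aut ⊤) :=
    Nat.card_congr (Subgroup.subgroupOfEquivOfLe hle).toEquiv
  have hmul := card_innerCategory_aut_top (P := P)
  rw [← hcard] at hmul
  have hpI : IsPGroup p I := by
    obtain ⟨n, hn⟩ := hP.exists_card_eq
    obtain ⟨m, -, hm⟩ := (Nat.dvd_prime_pow Fact.out).1 (hn ▸ Dvd.intro _ hmul)
    exact IsPGroup.of_card hm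
  refine ⟨hpI.toSylow fun hd => not_dvd_card_mul_pairMark hP hf hlen ⊤ ?_, rfl⟩
  have h1 := card_centralizer_dvd_pairMark hP hf.1 (⊤ : Subgroup P).subtype
  rw [card_toP_top, ← hmul, ← I.card_mul_index, ← mul_assoc, mul_comm p, Nat.cast_mul]
  exact mul_dvd_mul (Int.natCast_dvd_natCast.2 (mul_dvd_mul_left _ hd)) h1

end DivisibleCategory

end Puig

theorem proposition7p6 {p : ℕ} [Fact p.Prime] {P : Type*} [Group P] [Finite P]
    (hP : IsPGroup p P) (F : Puig.DivisibleCategory P) (f : Puig.Burnside P P)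
    (hf : f ∈ F.heckeInvariants) (hlen : IsCoprime (Puig.length f) (p : ℤ)) :
    F.IsFrobenius p ∧ Puig.stabilizerCategory f = F ∧ Puig.minimalHecke f = F.hecke :=
  ⟨⟨Puig.DivisibleCategory.exists_sylow_eq_inner hP hf hlen, fun _ _ hφ hc =>
      Puig.DivisibleCategory.exists_extension_of_fullyCentralized hP hf hlen hφ hc⟩,
    Puig.DivisibleCategory.stabilizerCategory_eq hP hf hlen,
    Puig.DivisibleCategory.minimalHecke_eq hP hf hlen⟩
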